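/- **Theorem (Zernike projection error).** Let $D=\{z\in\mathbb{R}^2: |z|<1\}$ be the open unit disc with polar coordinates $(\rho,\theta)$, and let $L^2(D)$ be the space of complex-valued square-integrable functions on $D$ with inner product $$\langle v,w\rangle_{L^2(D)}=\frac1\pi\int_0^{2\pi}\!\!\int_0^1\overline{v}\,w\;\rho\,d\rho\,d\theta .$$ For $m\in\mathbb{Z}$ and integers $n\ge 0$ let $$\zeta_{mn}(\rho,\theta)=\sqrt{1+|m|+2n}\;P_n^{(0,|m|)}(2\rho^2-1)\,\rho^{|m|}e^{im\theta},$$ where $P_n^{(a,b)}$ is the Jacobi polynomial, and for $v\in L^2(D)$ put $$\mathcal{P}_{MN}v=\sum_{|m|\le M}\ \sum_{0\le n\le N}\langle\zeta_{mn},v\rangle_{L^2(D)}\,\zeta_{mn}.$$ For an integer $k\ge 0$, $H^{2k}(D)$ is the space of functions $u \in L^2(D)$ whose weak derivatives of order at most $2k$ are in $L^2(D)$, with $\|u\|_{H^{2k}(D)}^2=\sum_{|\alpha|\le 2k}\|\partial^\alpha u\|_{L^2(D)}^2$. If $s=2(k+\nu)$ with an integer $k\ge0$ and $0<\nu<1$,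 let $S_k$ be the positive square root of the positive operator $S_k^2$ on $H^{2k+2}(D)$ defined by $\langle S_k^2u,w\rangle_{H^{2k+2}(D)}=\langle u,w\rangle_{H^{2k}(D)}$ for $u,w\in H^{2k+2}(D)$. Then $H^s(D)\subset L^2(D)$ is the completion of $H^{2k+2}(D)$ in the norm $\|u\|_{H^s(D)}=\|S_k^{1-\nu}u\|_{H^{2k+2}(D)}$: it consists of the limits $v$ in $L^2(D)$ of sequences $(u_j)$ in $H^{2k+2}(D)$ that are Cauchy in this norm, and $\|v\|_{H^s(D)}=\lim_j\|S_k^{1-\nu}u_j\|_{H^{2k+2}(D)}$. Then for every real $s>0$ there is a constant $P_s>0$, depending only on $s$, such that for all $v\in H^s(D)$ and all integers $M,N\ge 1$, $$\|v-\mathcal{P}_{MN}v\|_{L^2(D)}\le P_s\,\min(M,2N)^{-s}\,\|v\|_{H^s(D)} .$$ -/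

import Mathlib

open MeasureTheory Filter Topology
open scoped ENNReal ContDiff

noncomputable section

namespace ZernikeDisc

/-! ### The unit disc and `L²(D)`

The plane is `ℂ`, with coordinates `x = re z`, `y = im z` and polar coordinates `ρ = ‖z‖`,
`θ = arg z`. -/

/-- The open unit disc `D`. -/
def unitDisc : Set ℂ := Metric.ball 0 1

/-- Lebesgue measure on `D`, divided by `π`. -/
def discMeasure : Measure ℂ := (ENNReal.ofReal Real.pi)⁻¹ • volume.restrict unitDisc

/-- `L²(D)` with the inner product `⟨v, w⟩ = (1/π) ∫_D conj(v) w`. -/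
abbrev L2Disc : Type := Lp ℂ 2 discMeasure

instance : IsFiniteMeasure discMeasure := by
  refine ⟨?_⟩
  have h : volume unitDisc < ⊤ := by
    unfold unitDisc
    exact measure_ball_lt_top
  simp only [discMeasure, Measure.smul_apply, Measure.restrict_apply_univ, smul_eq_mul]
  refine ENNReal.mul_lt_top ?_ h
  simp [Real.pi_pos]

/-! ### Zernike polynomials -/

/-- The Jacobi polynomial `P_n^{(a,b)}` for natural numbers `a`, `b`:
`P_n^{(a,b)}(x) = ∑_{j ≤ n} C(n+a, n-j) C(n+b, j) ((x-1)/2)^j ((x+1)/2)^(n-j)`. -/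
def jacobiP (a b n : ℕ) (x : ℝ) : ℝ :=
  ∑ j ∈ Finset.range (n + 1),
    ((n + a).choose (n - j) : ℝ) * ((n + b).choose j : ℝ)
      * ((x - 1) / 2) ^ j * ((x + 1) / 2) ^ (n - j)

/-- `ζ_{mn}(ρ, θ) = √(1 + |m| + 2n) · P_n^{(0,|m|)}(2ρ² - 1) · ρ^{|m|} · e^{imθ}`. -/
def zernikeFun (m : ℤ) (n : ℕ) (z : ℂ) : ℂ :=
  ((Real.sqrt (1 + (m.natAbs : ℝ) + 2 * (n : ℝ))
      * jacobiP 0 m.natAbs n (2 * ‖z‖ ^ 2 - 1) * ‖z‖ ^ m.natAbs : ℝ) : ℂ)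
    * Complex.exp (Complex.I * (m : ℂ) * (Complex.arg z : ℂ))

lemma measurable_zernikeFun (m : ℤ) (n : ℕ) : Measurable (zernikeFun m n) := by
  unfold zernikeFun jacobiP
  have := Complex.measurable_arg
  fun_prop

lemma ae_mem_unitDisc : ∀ᵐ z ∂discMeasure, z ∈ unitDisc := by
  refine Measure.ae_smul_measure ?_ _
  exact ae_restrict_mem (by unfold unitDisc; exact measurableSet_ball)

lemma memLp_zernikeFun (m : ℤ) (n : ℕ) : MemLp (zernikeFun m n) 2 discMeasure := by
  have hc : Continuous (fun r : ℝ => Real.sqrt (1 + (m.natAbs : ℝ) + 2 * (n : ℝ))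
      * jacobiP 0 m.natAbs n (2 * r ^ 2 - 1) * r ^ m.natAbs) := by
    unfold jacobiP
    fun_prop
  obtain ⟨C, hC⟩ := (isCompact_Icc (a := (0 : ℝ)) (b := 1)).exists_bound_of_continuousOn
    hc.continuousOn
  refine MemLp.of_bound (measurable_zernikeFun m n).aestronglyMeasurable C ?_
  filter_upwards [ae_mem_unitDisc] with z hz
  have hz1 : ‖z‖ < 1 := by simpa [unitDisc] using hz
  have hexp : ‖Complex.exp (Complex.I * (m : ℂ) * (Complex.arg z : ℂ))‖ = 1 := by
    have : Complex.I * (m : ℂ) * (Complex.arg z : ℂ)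
        = (((m : ℝ) * Complex.arg z : ℝ) : ℂ) * Complex.I := by
      push_cast
      ring
    rw [this, Complex.norm_exp_ofReal_mul_I]
  unfold zernikeFun
  rw [norm_mul, hexp, mul_one, Complex.norm_real]
  exact hC ‖z‖ ⟨norm_nonneg z, hz1.le⟩

/-- `ζ_{mn}` as an element of `L²(D)`. -/
def zernike (m : ℤ) (n : ℕ) : L2Disc := (memLp_zernikeFun m n).toLp (zernikeFun m n)

/-- `P_{MN} v = ∑_{|m| ≤ M} ∑_{0 ≤ n ≤ N} ⟨ζ_{mn}, v⟩ ζ_{mn}`. -/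
def zernikeProj (M N : ℕ) (v : L2Disc) : L2Disc :=
  ∑ m ∈ Finset.Icc (-(M : ℤ)) (M : ℤ), ∑ n ∈ Finset.range (N + 1),
    inner ℂ (zernike m n) v • zernike m n

/-! ### Sobolev spaces of natural order -/

/-- The classical partial derivative `∂^α = ∂_x^{α₁} ∂_y^{α₂}`. -/
def partialDeriv (α : ℕ × ℕ) (φ : ℂ → ℂ) : ℂ → ℂ :=
  (fun ψ z => fderiv ℝ ψ z 1)^[α.1] ((fun ψ z => fderiv ℝ ψ z Complex.I)^[α.2] φ)

/-- Test functions: `φ ∈ C_c^∞(D)`. -/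
structure IsTestFunction (φ : ℂ → ℂ) : Prop where
  smooth : ContDiff ℝ ∞ φ
  compact : HasCompactSupport φ
  support : tsupport φ ⊆ unitDisc

/-- `g` is the weak derivative `∂^α u` on `D`. -/
def IsWeakDeriv (α : ℕ × ℕ) (u g : L2Disc) : Prop :=
  ∀ φ : ℂ → ℂ, IsTestFunction φ →
    ∫ z, u z * partialDeriv α φ z ∂discMeasure
      = (-1) ^ (α.1 + α.2) * ∫ z, g z * φ z ∂discMeasure

/-- The multi-indices `α` with `|α| ≤ m`. -/
def multiIndices (m : ℕ) : Finset (ℕ × ℕ) :=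
  (Finset.range (m + 1) ×ˢ Finset.range (m + 1)).filter fun α => α.1 + α.2 ≤ m

lemma mem_multiIndices {m : ℕ} {α : ℕ × ℕ} : α ∈ multiIndices m ↔ α.1 + α.2 ≤ m := by
  simp only [multiIndices, Finset.mem_filter, Finset.mem_product, Finset.mem_range]
  omega

/-- The multi-index `0`. -/
def zeroIndex (m : ℕ) : multiIndices m := ⟨(0, 0), mem_multiIndices.2 (by simp)⟩

lemma smooth_step {φ : ℂ → ℂ} (w : ℂ) (h : ContDiff ℝ ∞ φ ∧ HasCompactSupport φ) :
    ContDiff ℝ ∞ (fun z => fderiv ℝ φ z w) ∧ HasCompactSupport (fun z => fderiv ℝ φ z w) :=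
  ⟨(h.1.fderiv_right (m := ∞) (by simp)).clm_apply contDiff_const, h.2.fderiv_apply (𝕜 := ℝ) w⟩

lemma partialDeriv_smooth {φ : ℂ → ℂ} (α : ℕ × ℕ) (h : ContDiff ℝ ∞ φ ∧ HasCompactSupport φ) :
    ContDiff ℝ ∞ (partialDeriv α φ) ∧ HasCompactSupport (partialDeriv α φ) := by
  have key : ∀ (w : ℂ) (k : ℕ) (ψ : ℂ → ℂ), (ContDiff ℝ ∞ ψ ∧ HasCompactSupport ψ) →
      ContDiff ℝ ∞ ((fun ψ z => fderiv ℝ ψ z w)^[k] ψ)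
        ∧ HasCompactSupport ((fun ψ z => fderiv ℝ ψ z w)^[k] ψ) := by
    intro w k
    induction k with
    | zero => intro ψ hψ; exact hψ
    | succ k ih =>
      intro ψ hψ
      rw [Function.iterate_succ_apply]
      exact ih _ (smooth_step w hψ)
  exact key _ _ _ (key _ _ _ h)

lemma memLp_of_smooth {ψ : ℂ → ℂ} (h : ContDiff ℝ ∞ ψ ∧ HasCompactSupport ψ) :
    MemLp ψ 2 discMeasure :=
  h.1.continuous.memLp_of_hasCompactSupport h.2

lemma integral_mul_eq_inner (u : L2Disc) {ψ : ℂ → ℂ}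
    (hψ : MemLp (fun z => star (ψ z)) 2 discMeasure) :
    ∫ z, u z * ψ z ∂discMeasure = inner ℂ (hψ.toLp _) u := by
  rw [L2.inner_def]
  refine integral_congr_ae ?_
  filter_upwards [hψ.coeFn_toLp] with z hz
  rw [hz]
  simp [mul_comm]

/-- The jets `(∂^α u)_{|α| ≤ m}` of the functions `u ∈ L²(D)` with weak derivatives of order up to
`m` in `L²(D)`, with the norm `(∑_{|α| ≤ m} ‖∂^α u‖²)^{1/2}`. -/
def sobolevJets (m : ℕ) : Submodule ℂ (PiLp 2 fun _ : multiIndices m => L2Disc) where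
  carrier := {U | ∀ α : multiIndices m, IsWeakDeriv α (U (zeroIndex m)) (U α)}
  zero_mem' := by
    intro α φ hφ
    have h : MemLp (fun z => star (partialDeriv α φ z)) 2 discMeasure :=
      (memLp_of_smooth (partialDeriv_smooth α ⟨hφ.smooth, hφ.compact⟩)).star
    have h' : MemLp (fun z => star (φ z)) 2 discMeasure :=
      (memLp_of_smooth ⟨hφ.smooth, hφ.compact⟩).star
    rw [integral_mul_eq_inner _ h, integral_mul_eq_inner _ h']
    simp
  add_mem' := by
    intro U V hU hV α φ hφ
    have h : MemLp (fun z => star (partialDeriv α φ z)) 2 discMeasure :=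
      (memLp_of_smooth (partialDeriv_smooth α ⟨hφ.smooth, hφ.compact⟩)).star
    have h' : MemLp (fun z => star (φ z)) 2 discMeasure :=
      (memLp_of_smooth ⟨hφ.smooth, hφ.compact⟩).star
    have h1 := hU α φ hφ
    have h2 := hV α φ hφ
    rw [integral_mul_eq_inner _ h, integral_mul_eq_inner _ h'] at h1 h2 ⊢
    simp only [PiLp.add_apply, inner_add_right, h1, h2]
    ring
  smul_mem' := by
    intro c U hU α φ hφ
    have h : MemLp (fun z => star (partialDeriv α φ z)) 2 discMeasure :=
      (memLp_of_smooth (partialDeriv_smooth α ⟨hφ.smooth, hφ.compact⟩)).star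
    have h' : MemLp (fun z => star (φ z)) 2 discMeasure :=
      (memLp_of_smooth ⟨hφ.smooth, hφ.compact⟩).star
    have h1 := hU α φ hφ
    rw [integral_mul_eq_inner _ h, integral_mul_eq_inner _ h'] at h1 ⊢
    simp only [PiLp.smul_apply, inner_smul_right, h1]
    ring

lemma isClosed_sobolevJets (m : ℕ) :
    IsClosed (sobolevJets m : Set (PiLp 2 fun _ : multiIndices m => L2Disc)) := by
  have hset : (sobolevJets m : Set (PiLp 2 fun _ : multiIndices m => L2Disc))
      = ⋂ (α : multiIndices m) (φ : ℂ → ℂ) (_ : IsTestFunction φ),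
        {U | ∫ z, U (zeroIndex m) z * partialDeriv α φ z ∂discMeasure
          = (-1) ^ (α.1.1 + α.1.2) * ∫ z, U α z * φ z ∂discMeasure} := by
    ext U
    simp only [Set.mem_iInter]
    rfl
  rw [hset]
  refine isClosed_iInter fun α => isClosed_iInter fun φ => isClosed_iInter fun hφ => ?_
  have h : MemLp (fun z => star (partialDeriv α φ z)) 2 discMeasure :=
    (memLp_of_smooth (partialDeriv_smooth α ⟨hφ.smooth, hφ.compact⟩)).star
  have h' : MemLp (fun z => star (φ z)) 2 discMeasure :=
    (memLp_of_smooth ⟨hφ.smooth, hφ.compact⟩).star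
  simp_rw [integral_mul_eq_inner _ h, integral_mul_eq_inner _ h']
  refine isClosed_eq ?_ ?_ <;> fun_prop

/-- The Hilbert space `H^m(D)`, `m ∈ ℕ`, each function `u` being given together with its weak
derivatives `∂^α u`, `|α| ≤ m`. -/
abbrev HNat (m : ℕ) : Type := sobolevJets m

instance (m : ℕ) : CompleteSpace (HNat m) :=
  (isClosed_sobolevJets m).completeSpace_coe

/-- The function underlying an element of `H^m(D)`. -/
def toL2 (m : ℕ) : HNat m →L[ℂ] L2Disc :=
  (PiLp.proj 2 (fun _ : multiIndices m => L2Disc) (zeroIndex m) :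
    (PiLp 2 fun _ : multiIndices m => L2Disc) →L[ℂ] L2Disc).comp (sobolevJets m).subtypeL

lemma multiIndices_mono {m m' : ℕ} (h : m ≤ m') {α : ℕ × ℕ} (hα : α ∈ multiIndices m) :
    α ∈ multiIndices m' :=
  mem_multiIndices.2 ((mem_multiIndices.1 hα).trans h)

/-- The inclusion `H^{m'}(D) → H^m(D)` for `m ≤ m'`. -/
def incl {m m' : ℕ} (h : m ≤ m') : HNat m' →L[ℂ] HNat m :=
  ContinuousLinearMap.codRestrict
    ((PiLp.continuousLinearEquiv 2 ℂ fun _ : multiIndices m => L2Disc).symm.toContinuousLinearMap.comp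
      ((ContinuousLinearMap.pi fun α : multiIndices m =>
        PiLp.proj 2 (fun _ : multiIndices m' => L2Disc)
          (⟨α.1, multiIndices_mono h α.2⟩ : multiIndices m')).comp (sobolevJets m').subtypeL))
    (sobolevJets m) (fun u α => u.2 ⟨α.1, multiIndices_mono h α.2⟩)

lemma norm_sq_HNat (m : ℕ) (u : HNat m) :
    ‖u‖ ^ 2 = ∑ α : multiIndices m, ‖(u : PiLp 2 fun _ : multiIndices m => L2Disc) α‖ ^ 2 :=
  PiLp.norm_sq_eq_of_L2 _ _

lemma toL2_incl {m m' : ℕ} (h : m ≤ m') (u : HNat m') : toL2 m (incl h u) = toL2 m' u := rfl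

/-- A function in `H^m(D)` determines its weak derivatives. -/
lemma toL2_injective (m : ℕ) : Function.Injective (toL2 m) := by
  rw [injective_iff_map_eq_zero]
  intro u hu
  have hu0 : (u : PiLp 2 fun _ : multiIndices m => L2Disc) (zeroIndex m) = 0 := hu
  ext1
  ext1 α
  set g : L2Disc := (u : PiLp 2 fun _ : multiIndices m => L2Disc) α with hg
  change g = 0
  have hint : ∀ φ : ℂ → ℂ, IsTestFunction φ → ∫ z, g z * φ z ∂discMeasure = 0 := by
    intro φ hφ
    have h1 := u.2 α φ hφ
    rw [hu0] at h1
    have h : MemLp (fun z => star (partialDeriv α φ z)) 2 discMeasure :=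
      (memLp_of_smooth (partialDeriv_smooth α ⟨hφ.smooth, hφ.compact⟩)).star
    rw [integral_mul_eq_inner _ h, inner_zero_right] at h1
    have hne : ((-1 : ℂ) ^ (α.1.1 + α.1.2)) ≠ 0 := by simp
    exact (mul_eq_zero.1 h1.symm).resolve_left hne
  have hloc : LocallyIntegrableOn (fun z => g z) unitDisc discMeasure :=
    ((Lp.memLp g).integrable (by norm_num)).locallyIntegrable.locallyIntegrableOn _
  have hae := IsOpen.ae_eq_zero_of_integral_contDiff_smul_eq_zero
    (U := unitDisc) (by unfold unitDisc; exact Metric.isOpen_ball) hloc (by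
      intro φ h1 h2 h3
      have hsupp : Function.support (fun z => ((φ z : ℝ) : ℂ)) = Function.support φ := by
        ext z
        simp
      have := hint (fun z => ((φ z : ℝ) : ℂ))
        ⟨Complex.ofRealCLM.contDiff.comp h1, by
          rw [HasCompactSupport, tsupport, hsupp]; exact h2, by
          rw [tsupport, hsupp]; exact h3⟩
      rw [← this]
      refine integral_congr_ae (Eventually.of_forall fun z => ?_)
      simp [mul_comm])
  refine (Lp.eq_zero_iff_ae_eq_zero).2 ?_
  filter_upwards [hae, ae_mem_unitDisc] with z h1 h2
  exact h1 h2

/-! ### Sobolev spaces of real order -/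

/-- The operator `S_k²` on `H^{2k+2}(D)`; it is determined by `inner_opSq`. -/
def opSq (k : ℕ) : HNat (2 * k + 2) →L[ℂ] HNat (2 * k + 2) :=
  ContinuousLinearMap.adjoint (incl (Nat.le_add_right (2 * k) 2))
    ∘L incl (Nat.le_add_right (2 * k) 2)

lemma inner_opSq (k : ℕ) (u v : HNat (2 * k + 2)) :
    inner ℂ (opSq k u) v
      = inner ℂ (incl (Nat.le_add_right (2 * k) 2) u) (incl (Nat.le_add_right (2 * k) 2) v) := by
  simp [opSq, ContinuousLinearMap.adjoint_inner_left]

lemma opSq_nonneg (k : ℕ) : 0 ≤ opSq k :=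
  (ContinuousLinearMap.nonneg_iff_isPositive _).2
    (ContinuousLinearMap.isPositive_adjoint_comp_self _)

section

variable {H : Type*} [NormedAddCommGroup H] [InnerProductSpace ℂ H] [CompleteSpace H]

/-- The positive square root of a positive operator (spectral calculus). -/
def posSqrt (T : H →L[ℂ] H) : H →L[ℂ] H := CFC.sqrt T

/-- The power `T^a`, `a > 0`, of a positive operator (spectral calculus). -/
def posRpow (T : H →L[ℂ] H) (a : ℝ) : H →L[ℂ] H := T ^ a

lemma posSqrt_posSqrt {T : H →L[ℂ] H} (hT : 0 ≤ T) (x : H) : posSqrt T (posSqrt T x) = T x :=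
  congrArg (fun A : H →L[ℂ] H => A x) (CFC.sqrt_mul_sqrt_self T hT)

lemma posRpow_posRpow (T : H →L[ℂ] H) {ν : ℝ} (h0 : 0 < ν) (h1 : ν < 1) (x : H) :
    posRpow (posSqrt T) ν (posRpow (posSqrt T) (1 - ν) x) = posSqrt T x
      ∧ posRpow (posSqrt T) (1 - ν) (posRpow (posSqrt T) ν x) = posSqrt T x := by
  have hS : 0 ≤ posSqrt T := CFC.sqrt_nonneg T
  lift ν to NNReal using h0.le
  have h0' : 0 < ν := by exact_mod_cast h0
  have h1' : ν < 1 := by exact_mod_cast h1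
  have h2 : 0 < 1 - ν := tsub_pos_of_lt h1'
  have hc : ((1 - ν : NNReal) : ℝ) = 1 - (ν : ℝ) := by
    rw [NNReal.coe_sub h1'.le, NNReal.coe_one]
  have e1 : posRpow (posSqrt T) (ν : ℝ) = posSqrt T ^ ν := (CFC.nnrpow_eq_rpow h0').symm
  have e2 : posRpow (posSqrt T) (1 - (ν : ℝ)) = posSqrt T ^ (1 - ν) := by
    rw [← hc]
    exact (CFC.nnrpow_eq_rpow h2).symm
  have k1 : posSqrt T ^ ν * posSqrt T ^ (1 - ν) = posSqrt T := by
    rw [← CFC.nnrpow_add h0' h2, add_tsub_cancel_of_le h1'.le, CFC.nnrpow_one _ hS]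
  have k2 : posSqrt T ^ (1 - ν) * posSqrt T ^ ν = posSqrt T := by
    rw [← CFC.nnrpow_add h2 h0', tsub_add_cancel_of_le h1'.le, CFC.nnrpow_one _ hS]
  rw [e1, e2]
  exact ⟨congrArg (fun A : H →L[ℂ] H => A x) k1, congrArg (fun A : H →L[ℂ] H => A x) k2⟩

lemma norm_sq_posSqrt {T : H →L[ℂ] H} (hT : 0 ≤ T) (x : H) :
    ‖posSqrt T x‖ ^ 2 = RCLike.re (inner ℂ (T x) x) := by
  have hS : 0 ≤ posSqrt T := CFC.sqrt_nonneg T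
  have hsym := ((ContinuousLinearMap.nonneg_iff_isPositive _).1 hS).isSymmetric
  have h := hsym (posSqrt T x) x
  rw [← posSqrt_posSqrt hT x, norm_sq_eq_re_inner (𝕜 := ℂ)]
  exact congrArg RCLike.re h.symm

end

/-- `S_k`, the positive square root of `S_k²`. -/
def opS (k : ℕ) : HNat (2 * k + 2) →L[ℂ] HNat (2 * k + 2) := posSqrt (opSq k)

/-- `S_k^{1-ν}`. -/
def opSpow (k : ℕ) (ν : ℝ) : HNat (2 * k + 2) →L[ℂ] HNat (2 * k + 2) :=
  posRpow (opS k) (1 - ν)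

/-- For `0 < ν < 1`: the closure in `L²(D) × H^{2k+2}(D)` of the set of pairs `(u, S_k^{1-ν} u)`,
`u ∈ H^{2k+2}(D)`. Its elements are the pairs `(v, w)` for which there are `u_j ∈ H^{2k+2}(D)` with
`u_j → v` in `L²(D)` and `S_k^{1-ν} u_j → w` in `H^{2k+2}(D)`. -/
def fracGraph (k : ℕ) (ν : ℝ) : Submodule ℂ (L2Disc × HNat (2 * k + 2)) :=
  (LinearMap.range ((toL2 (2 * k + 2)).prod (opSpow k ν) :
    HNat (2 * k + 2) →ₗ[ℂ] L2Disc × HNat (2 * k + 2))).topologicalClosure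

/-- The integer `k` in `s = 2 (k + ν)`, `0 ≤ ν < 1`. -/
def evenPart (s : ℝ) : ℕ := ⌊s / 2⌋₊

/-- The number `ν` in `s = 2 (k + ν)`, `0 ≤ ν < 1`. -/
def fracPart (s : ℝ) : ℝ := s / 2 - (evenPart s : ℝ)

open scoped Classical in
/-- `H^s(D)` for real `s ≥ 0`, as a space of functions in `L²(D)`. If `s = 2k` this is the Sobolev
space of order `2k`; if `s = 2 (k + ν)` with `0 < ν < 1`, it is the completion in `L²(D)` of
`H^{2k+2}(D)` for the norm `‖S_k^{1-ν} u‖_{H^{2k+2}(D)}`. -/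
def SobolevSpace (s : ℝ) : Submodule ℂ L2Disc :=
  if fracPart s = 0 then
    LinearMap.range (toL2 (2 * evenPart s) : HNat (2 * evenPart s) →ₗ[ℂ] L2Disc)
  else
    (fracGraph (evenPart s) (fracPart s)).map (LinearMap.fst ℂ _ _)

open scoped Classical in
/-- `‖v‖_{H^s(D)}` for `v ∈ H^s(D)`. If `s = 2k` this is `(∑_{|α| ≤ 2k} ‖∂^α v‖²)^{1/2}`; if
`s = 2 (k + ν)` with `0 < ν < 1`, it is the continuous extension to the completion of the norm
`‖S_k^{1-ν} u‖_{H^{2k+2}(D)}`. Both infima are over a single number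
(see `sobolevNorm_eq_of_even` and `sobolevNorm_eq_of_frac`). -/
def sobolevNorm (s : ℝ) (v : L2Disc) : ℝ :=
  if fracPart s = 0 then
    sInf {r | ∃ u : HNat (2 * evenPart s), toL2 _ u = v ∧ r = ‖u‖}
  else
    sInf {r | ∃ w : HNat (2 * evenPart s + 2),
      (v, w) ∈ fracGraph (evenPart s) (fracPart s) ∧ r = ‖w‖}

lemma norm_opS (k : ℕ) (u : HNat (2 * k + 2)) :
    ‖opS k u‖ = ‖incl (Nat.le_add_right (2 * k) 2) u‖ := by
  have h' : ‖opS k u‖ ^ 2 = ‖incl (Nat.le_add_right (2 * k) 2) u‖ ^ 2 := by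
    refine (norm_sq_posSqrt (opSq_nonneg k) u).trans ?_
    refine (congrArg RCLike.re (inner_opSq k u u)).trans ?_
    exact (norm_sq_eq_re_inner (𝕜 := ℂ) (incl (Nat.le_add_right (2 * k) 2) u)).symm
  exact (sq_eq_sq₀ (norm_nonneg _) (norm_nonneg _)).1 h'

/-- The space `fracGraph k ν` is the graph of a function of `v`. -/
lemma fracGraph_zero (k : ℕ) {ν : ℝ} (h0 : 0 < ν) (h1 : ν < 1) (w : HNat (2 * k + 2))
    (hw : ((0 : L2Disc), w) ∈ fracGraph k ν) : w = 0 := by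
  have hmem : ((0 : L2Disc), w) ∈ closure (Set.range fun u : HNat (2 * k + 2) =>
      (toL2 (2 * k + 2) u, opSpow k ν u)) := by
    have := hw
    rw [fracGraph, ← SetLike.mem_coe, Submodule.topologicalClosure_coe] at this
    exact this
  obtain ⟨p, hp, hlim⟩ := mem_closure_iff_seq_limit.1 hmem
  choose u hu using hp
  have hA : Tendsto (fun j => toL2 (2 * k + 2) (u j)) atTop (𝓝 0) := by
    have := (continuous_fst.tendsto _).comp hlim
    refine this.congr fun j => ?_
    simp [← hu j]
  have hB : Tendsto (fun j => opSpow k ν (u j)) atTop (𝓝 w) := by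
    have := (continuous_snd.tendsto _).comp hlim
    refine this.congr fun j => ?_
    simp [← hu j]
  have hC : Tendsto (fun j => opS k (u j)) atTop (𝓝 (posRpow (opS k) ν w)) := by
    have := ((posRpow (opS k) ν).continuous.tendsto w).comp hB
    refine this.congr fun j => ?_
    exact (posRpow_posRpow (opSq k) h0 h1 (u j)).1
  have hcau : CauchySeq fun j => incl (Nat.le_add_right (2 * k) 2) (u j) := by
    have h := hC.cauchySeq
    rw [Metric.cauchySeq_iff] at h ⊢
    intro ε hε
    obtain ⟨N, hN⟩ := h ε hε
    refine ⟨N, fun m hm n hn => ?_⟩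
    have := hN m hm n hn
    rw [dist_eq_norm, ← map_sub] at this ⊢
    rwa [← norm_opS]
  obtain ⟨y, hy⟩ := cauchySeq_tendsto_of_complete hcau
  have hy0 : y = 0 := by
    apply toL2_injective (2 * k)
    rw [map_zero]
    exact tendsto_nhds_unique (((toL2 (2 * k)).continuous.tendsto y).comp hy) hA
  have hS0 : posRpow (opS k) ν w = 0 := by
    rw [← norm_eq_zero]
    refine tendsto_nhds_unique hC.norm ?_
    have := hy.norm
    rw [hy0, norm_zero] at this
    exact this.congr fun j => (norm_opS k (u j)).symm
  have hSw : opS k w = 0 := by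
    have := (posRpow_posRpow (opSq k) h0 h1 w).2
    change posRpow (opS k) (1 - ν) (posRpow (opS k) ν w) = opS k w at this
    rw [← this, hS0, map_zero]
  have hi : incl (Nat.le_add_right (2 * k) 2) w = 0 := by
    rw [← norm_eq_zero, ← norm_opS, hSw, norm_zero]
  apply toL2_injective (2 * k + 2)
  rw [map_zero, ← toL2_incl (Nat.le_add_right (2 * k) 2), hi, map_zero]

lemma sobolevNorm_eq_of_even {s : ℝ} (h : fracPart s = 0) (u : HNat (2 * evenPart s)) :
    sobolevNorm s (toL2 _ u) = ‖u‖ := by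
  have : {r | ∃ u' : HNat (2 * evenPart s), toL2 _ u' = toL2 _ u ∧ r = ‖u'‖} = {‖u‖} := by
    ext r
    constructor
    · rintro ⟨u', h1, h2⟩
      rw [h2, toL2_injective _ h1]
      rfl
    · intro hr
      exact ⟨u, rfl, hr⟩
  rw [sobolevNorm, if_pos h, this, csInf_singleton]

lemma sobolevNorm_eq_of_frac {s : ℝ} (hs : 0 ≤ s) (h : fracPart s ≠ 0) {v : L2Disc}
    {w : HNat (2 * evenPart s + 2)} (hw : (v, w) ∈ fracGraph (evenPart s) (fracPart s)) :
    sobolevNorm s v = ‖w‖ := by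
  have h0 : 0 < fracPart s := by
    refine lt_of_le_of_ne ?_ h.symm
    exact sub_nonneg.2 (Nat.floor_le (by positivity))
  have h1 : fracPart s < 1 := by
    have := Nat.lt_floor_add_one (s / 2)
    rw [fracPart, evenPart]
    linarith
  have : {r | ∃ w' : HNat (2 * evenPart s + 2),
      (v, w') ∈ fracGraph (evenPart s) (fracPart s) ∧ r = ‖w'‖} = {‖w‖} := by
    ext r
    constructor
    · rintro ⟨w', h2, h3⟩
      have h4 := (fracGraph (evenPart s) (fracPart s)).sub_mem h2 hw
      rw [Prod.mk_sub_mk, sub_self] at h4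
      rw [h3, sub_eq_zero.1 (fracGraph_zero _ h0 h1 _ h4)]
      rfl
    · intro hr
      exact ⟨w, hw, hr⟩
  rw [sobolevNorm, if_neg h, this, csInf_singleton]

end ZernikeDisc

end

open ZernikeDisc

/-!
The Zernike functions are eigenfunctions of the degenerate elliptic operator
`K = -∂_x (1 - |z|²) ∂_x - ∂_y (1 - |z|²) ∂_y - ∂_θ²`, with eigenvalue `d (d + 2)` at `ζ_{mn}`,
where `d = |m| + 2 n` is the degree. If `(m, n)` is not in the index range of `P_{MN}` then
`d > min(M, 2N) =: a`. Hence `a^{2k} ‖v - P_{MN} v‖ ≤ ‖K^k v‖` for `v ∈ H^{2k}(D)`, which is the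
theorem for even integers `s = 2k`. This uses the following facts.

* `K` is symmetric with respect to functions that satisfy no boundary condition, because it is built
  from vector fields tangent to the circle: a cut-off `χ(j (1 - |z|²))` has a bounded derivative
  along such fields (`integral_weakWirt_mul_tangent`). In particular `K v` is defined weakly for
  `v ∈ H²(D)` (`exists_weak_zernikeOp`).
* In the variables `z` and `conj z` the operator `K` is triangular on monomials (`zernikeOp_zmono`),
  and the recurrence that an eigenvector has to satisfy is that of the coefficients of
  `P_n^{(0,|m|)}(2 t - 1)`, found from Rodrigues' formula (`jacobiP_eq_sum`, `zernikeOp_zpoly`).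
* The Zernike functions are an orthonormal basis (`zernikeBasis`). They are orthogonal because they
  belong to different joint eigenvalues of the symmetric operators `K` and `-i ∂_θ`, the norm is
  computed from the Gram matrix of the monomials (`cauchy_form_mul_eq_one`), and completeness is the
  Stone-Weierstrass theorem, as the Zernike polynomials span all polynomials in `z` and `conj z`.

The uniform bound `‖K^k v‖ ≤ C ‖v‖_{H^{2k}}` comes for free from the Banach-Steinhaus theorem
(`exists_norm_sub_zernikeProj_le`).

For `s = 2 (k + ν)` with `0 < ν < 1`, let `T` be the restriction of `1 - P_{MN}` to `H^{2k+2}(D)`.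
The bounds of orders `2k` and `2k + 2` say that `T* T ≤ A S_k²` and `T* T ≤ B`. By the Löwner-Heinz
inequality `T* T ≤ B^ν (T* T)^{1-ν} ≤ B^ν A^{1-ν} S_k^{2(1-ν)}` (`norm_le_norm_posRpow`), which is
the theorem on `H^{2k+2}(D)`, and it passes to the completion.
-/

noncomputable section

namespace ZernikeDisc

/-! ### Wirtinger derivatives, classical and weak -/

/-- The first-order operator `(∂_x + c ∂_y) / 2`. It is the Wirtinger derivative `∂ = ∂/∂z` for
`c = -i` and `∂bar` for `c = i`. -/
def wirt (c : ℂ) (f : ℂ → ℂ) (z : ℂ) : ℂ :=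
  (fderiv ℝ f z 1 + c * fderiv ℝ f z Complex.I) / 2

lemma wirt_mul (c : ℂ) {f g : ℂ → ℂ} {z : ℂ} (hf : DifferentiableAt ℝ f z)
    (hg : DifferentiableAt ℝ g z) :
    wirt c (fun z => f z * g z) z = f z * wirt c g z + wirt c f z * g z := by
  have h := fderiv_fun_mul hf hg
  simp only [wirt, h, add_apply, smul_apply, smul_eq_mul]
  ring

lemma contDiff_wirt (c : ℂ) {f : ℂ → ℂ} (hf : ContDiff ℝ ∞ f) : ContDiff ℝ ∞ (wirt c f) := by
  have h := hf.fderiv_right (m := ∞) (by simp)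
  unfold wirt
  exact ((h.clm_apply contDiff_const).add
    (contDiff_const.mul (h.clm_apply contDiff_const))).div_const 2

/-- The function `g` is the weak derivative `(∂_x + c ∂_y) u / 2` on the disc. -/
def IsWeakWirt (c : ℂ) (u g : ℂ → ℂ) : Prop :=
  ∀ φ : ℂ → ℂ, IsTestFunction φ →
    ∫ z, u z * wirt c φ z ∂discMeasure = -∫ z, g z * φ z ∂discMeasure

lemma exists_bound_on_disc {f : ℂ → ℂ} (hf : Continuous f) :
    ∃ C, ∀ z ∈ unitDisc, ‖f z‖ ≤ C := by
  obtain ⟨C, hC⟩ := (isCompact_closedBall (0 : ℂ) 1).exists_bound_of_continuousOn hf.continuousOn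
  exact ⟨C, fun z hz => hC z (Metric.ball_subset_closedBall hz)⟩

lemma memLp_mul_continuous {u f : ℂ → ℂ} (hu : MemLp u 2 discMeasure) (hf : Continuous f) :
    MemLp (fun z => u z * f z) 2 discMeasure := by
  obtain ⟨C, hC⟩ := exists_bound_on_disc hf
  refine hu.of_le_mul (c := C) (hu.1.mul hf.aestronglyMeasurable) ?_
  filter_upwards [ae_mem_unitDisc] with z hz
  rw [norm_mul, mul_comm]
  exact mul_le_mul_of_nonneg_right (hC z hz) (norm_nonneg _)

lemma integrable_mul_continuous {u f : ℂ → ℂ} (hu : MemLp u 2 discMeasure) (hf : Continuous f) :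
    Integrable (fun z => u z * f z) discMeasure :=
  (memLp_mul_continuous hu hf).integrable (by norm_num)

lemma memLp_of_continuous {f : ℂ → ℂ} (hf : Continuous f) : MemLp f 2 discMeasure := by
  simpa using memLp_mul_continuous (memLp_const (1 : ℂ)) hf

/-! ### Integration by parts for vector fields tangent to the circle -/

/-- A radial cut-off, equal to `1` where `j (1 - |z|²) ≥ 2` and to `0` where `j (1 - |z|²) ≤ 1`. -/
def cutoff (j : ℕ) (z : ℂ) : ℂ :=
  (Real.smoothTransition (j * (1 - Complex.normSq z) - 1) : ℝ)

lemma contDiff_normSq : ContDiff ℝ ∞ (fun z : ℂ => Complex.normSq z) := by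
  simp only [Complex.normSq_apply]
  exact (Complex.reCLM.contDiff.mul Complex.reCLM.contDiff).add
    (Complex.imCLM.contDiff.mul Complex.imCLM.contDiff)

lemma contDiff_cutoff (j : ℕ) : ContDiff ℝ ∞ (cutoff j) :=
  Complex.ofRealCLM.contDiff.comp (Real.smoothTransition.contDiff.comp
    ((contDiff_const.mul (contDiff_const.sub contDiff_normSq)).sub contDiff_const))

lemma wirt_cutoff (c : ℂ) (j : ℕ) (z : ℂ) :
    wirt c (cutoff j) z = -(j * deriv Real.smoothTransition (j * (1 - Complex.normSq z) - 1) : ℝ)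
      * (z.re + c * z.im) := by
  have hre : HasFDerivAt (fun z : ℂ => z.re) Complex.reCLM z := Complex.reCLM.hasFDerivAt
  have him : HasFDerivAt (fun z : ℂ => z.im) Complex.imCLM z := Complex.imCLM.hasFDerivAt
  have h1 : HasFDerivAt (fun z : ℂ => (j : ℝ) * (1 - (z.re * z.re + z.im * z.im)) - 1) _ z :=
    ((((hre.mul hre).add (him.mul him)).const_sub 1).const_mul (j : ℝ)).sub_const 1
  have hs : HasDerivAt Real.smoothTransition
      (deriv Real.smoothTransition (j * (1 - (z.re * z.re + z.im * z.im)) - 1))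
      (j * (1 - (z.re * z.re + z.im * z.im)) - 1) :=
    ((Real.smoothTransition.contDiff (n := 1)).differentiable (by simp) _).hasDerivAt
  have h2 := Complex.ofRealCLM.hasFDerivAt.comp z (hs.comp_hasFDerivAt z h1)
  have h3 : cutoff j = Complex.ofRealCLM ∘ (Real.smoothTransition ∘
      fun z : ℂ => j * (1 - (z.re * z.re + z.im * z.im)) - 1) := by
    ext z
    simp [cutoff, Complex.normSq_apply]
  rw [wirt, h3, h2.fderiv, Complex.normSq_apply]
  simp
  ring

lemma isTestFunction_cutoff_mul {j : ℕ} (hj : 0 < j) {q : ℂ → ℂ} (hq : ContDiff ℝ ∞ q) :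
    IsTestFunction (fun z => cutoff j z * q z) := by
  have hj' : (0 : ℝ) < j := by exact_mod_cast hj
  set S : Set ℂ := {z | 0 ≤ (j : ℝ) * (1 - Complex.normSq z) - 1} with hS
  have hSc : IsClosed S :=
    isClosed_le continuous_const (by have := Complex.continuous_normSq; fun_prop)
  have hsub : S ⊆ unitDisc := by
    intro z hz
    have hz' : 0 ≤ (j : ℝ) * (1 - Complex.normSq z) - 1 := hz
    have h1 : ‖z‖ ^ 2 < 1 := by
      rw [← Complex.normSq_eq_norm_sq]
      by_contra! h
      have : (j : ℝ) * (1 - Complex.normSq z) ≤ 0 :=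
        mul_nonpos_of_nonneg_of_nonpos hj'.le (by linarith)
      linarith
    have h2 : ‖z‖ < 1 := by
      have := norm_nonneg z
      nlinarith
    simpa [unitDisc] using h2
  have hts : tsupport (fun z => cutoff j z * q z) ⊆ S := by
    refine closure_minimal ?_ hSc
    intro z hz
    by_contra hzS
    apply hz
    have : (j : ℝ) * (1 - Complex.normSq z) - 1 ≤ 0 := by
      simp only [hS, Set.mem_ofPred_eq, not_le] at hzS
      exact hzS.le
    simp [cutoff, Real.smoothTransition.zero_of_nonpos this]
  refine ⟨(contDiff_cutoff j).mul hq, ?_, hts.trans hsub⟩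
  refine Metric.isCompact_of_isClosed_isBounded (isClosed_tsupport _) ?_
  exact Metric.isBounded_ball.subset (hts.trans hsub)

lemma deriv_smoothTransition_of_one_lt {t : ℝ} (ht : 1 < t) :
    deriv Real.smoothTransition t = 0 := by
  have : Real.smoothTransition =ᶠ[𝓝 t] fun _ => (1 : ℝ) := by
    filter_upwards [lt_mem_nhds ht] with s hs
    exact Real.smoothTransition.one_of_one_le hs.le
  rw [this.deriv_eq, deriv_const]

lemma deriv_smoothTransition_of_neg {t : ℝ} (ht : t < 0) :
    deriv Real.smoothTransition t = 0 := by
  have : Real.smoothTransition =ᶠ[𝓝 t] fun _ => (0 : ℝ) := by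
    filter_upwards [gt_mem_nhds ht] with s hs
    exact Real.smoothTransition.zero_of_nonpos hs.le
  rw [this.deriv_eq, deriv_const]

/-- With `t = j (1 - |z|²) - 1` this bounds the derivative of the cut-off along tangential fields,
uniformly in `j`. -/
lemma exists_bound_mul_deriv_smoothTransition :
    ∃ C, ∀ t : ℝ, |(t + 1) * deriv Real.smoothTransition t| ≤ C := by
  have hc : Continuous fun t : ℝ => (t + 1) * deriv Real.smoothTransition t :=
    (by fun_prop : Continuous fun t : ℝ => t + 1).mul
      ((Real.smoothTransition.contDiff (n := 1)).continuous_deriv le_rfl)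
  obtain ⟨C, hC⟩ := (isCompact_Icc (a := (0 : ℝ)) (b := 1)).exists_bound_of_continuousOn
    hc.continuousOn
  refine ⟨C, fun t => ?_⟩
  have hC0 : 0 ≤ C := (norm_nonneg _).trans (hC 0 (by simp))
  by_cases h0 : t < 0
  · simpa [deriv_smoothTransition_of_neg h0] using hC0
  by_cases h1 : 1 < t
  · simpa [deriv_smoothTransition_of_one_lt h1] using hC0
  · exact hC t ⟨not_lt.1 h0, not_lt.1 h1⟩

lemma tendsto_cutoff_arg {z : ℂ} (hz : z ∈ unitDisc) :
    Tendsto (fun j : ℕ => ((j + 1 : ℕ) : ℝ) * (1 - Complex.normSq z) - 1) atTop atTop := by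
  have h1 : ‖z‖ < 1 := by simpa [unitDisc] using hz
  have h2 : 0 < 1 - Complex.normSq z := by
    rw [Complex.normSq_eq_norm_sq]
    have := norm_nonneg z
    nlinarith
  refine tendsto_atTop_add_const_right _ _ ?_
  exact Tendsto.atTop_mul_const h2
    (tendsto_natCast_atTop_atTop.comp (tendsto_add_atTop_nat 1))

/-- Integration by parts on the disc, against a smooth vector field `q ∂ + qb ∂bar` that is tangent
to the circle: it maps `1 - |z|²` to a multiple of itself. There is no boundary term, although `u`
satisfies no boundary condition: the derivative of the cut-off along the field stays bounded. -/
theorem integral_weakWirt_mul_tangent {u g gb q qb r : ℂ → ℂ} (hu : MemLp u 2 discMeasure)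
    (hg : MemLp g 2 discMeasure) (hgb : MemLp gb 2 discMeasure)
    (hug : IsWeakWirt (-Complex.I) u g) (hugb : IsWeakWirt Complex.I u gb)
    (hq : ContDiff ℝ ∞ q) (hqb : ContDiff ℝ ∞ qb) (hr : Continuous r)
    (htan : ∀ z, star z * q z + z * qb z = (1 - Complex.normSq z) * r z) :
    ∫ z, (g z * q z + gb z * qb z) ∂discMeasure
      = -∫ z, u z * (wirt (-Complex.I) q z + wirt Complex.I qb z) ∂discMeasure := by
  -- the cut-offs have index `j + 1`, as the one of index `0` is not supported in the disc
  set s : ℝ → ℝ := Real.smoothTransition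
  let t : ℕ → ℂ → ℝ := fun j z => ((j + 1 : ℕ) : ℝ) * (1 - Complex.normSq z) - 1
  have htc : ∀ j, Continuous (t j) := fun j => by
    have := Complex.continuous_normSq
    fun_prop
  let e : ℕ → ℂ → ℂ := fun j z => (((t j z + 1) * deriv s (t j z) : ℝ) : ℂ)
  have hec : ∀ j, Continuous (e j) := fun j => by
    have h1 := (Real.smoothTransition.contDiff (n := 1)).continuous_deriv le_rfl
    exact Complex.continuous_ofReal.comp (((htc j).add continuous_const).mul (h1.comp (htc j)))
  have hcc : ∀ j, Continuous (cutoff j) := fun j => (contDiff_cutoff j).continuous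
  have hDq := (contDiff_wirt (-Complex.I) hq).continuous
  have hDqb := (contDiff_wirt Complex.I hqb).continuous
  have key : ∀ j : ℕ, ∫ z, (g z * q z + gb z * qb z) * cutoff (j + 1) z ∂discMeasure
      = -∫ z, u z * (cutoff (j + 1) z * (wirt (-Complex.I) q z + wirt Complex.I qb z)
        - e j z * r z) ∂discMeasure := by
    intro j
    have h1 := hug _ (isTestFunction_cutoff_mul (Nat.succ_pos j) hq)
    have h2 := hugb _ (isTestFunction_cutoff_mul (Nat.succ_pos j) hqb)
    have hd : ∀ f : ℂ → ℂ, ContDiff ℝ ∞ f → ∀ z, DifferentiableAt ℝ f z :=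
      fun f hf z => hf.differentiable (by simp) z
    have i1 : Integrable (fun z => u z * wirt (-Complex.I) (fun z => cutoff (j + 1) z * q z) z)
        discMeasure :=
      integrable_mul_continuous hu (contDiff_wirt _ ((contDiff_cutoff _).mul hq)).continuous
    have i2 : Integrable (fun z => u z * wirt Complex.I (fun z => cutoff (j + 1) z * qb z) z)
        discMeasure :=
      integrable_mul_continuous hu (contDiff_wirt _ ((contDiff_cutoff _).mul hqb)).continuous
    have i3 : Integrable (fun z => g z * (cutoff (j + 1) z * q z)) discMeasure :=
      integrable_mul_continuous hg ((hcc _).mul hq.continuous)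
    have i4 : Integrable (fun z => gb z * (cutoff (j + 1) z * qb z)) discMeasure :=
      integrable_mul_continuous hgb ((hcc _).mul hqb.continuous)
    have h3 : ∫ z, (g z * q z + gb z * qb z) * cutoff (j + 1) z ∂discMeasure
        = ∫ z, g z * (cutoff (j + 1) z * q z) ∂discMeasure
          + ∫ z, gb z * (cutoff (j + 1) z * qb z) ∂discMeasure := by
      rw [← integral_add i3 i4]
      congr 1
      ext z
      ring
    rw [h3, ← neg_inj, neg_add, ← h1, ← h2, neg_neg, ← integral_add i1 i2]
    congr 1
    ext z
    rw [wirt_mul _ (hd _ (contDiff_cutoff _) z) (hd _ hq z),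
      wirt_mul _ (hd _ (contDiff_cutoff _) z) (hd _ hqb z), wirt_cutoff, wirt_cutoff]
    have hz1 : (z.re : ℂ) + -Complex.I * z.im = star z := by
      apply Complex.ext <;> simp
    have hz2 : (z.re : ℂ) + Complex.I * z.im = z := by
      apply Complex.ext <;> simp
    -- the field differentiates the cut-off to `-j s'(t) (1 - |z|²) r`, where `j (1 - |z|²) = t + 1`
    have he : e j z * r z = (((j + 1 : ℕ) : ℝ) * deriv s (t j z) : ℝ)
        * (star z * q z + z * qb z) := by
      rw [htan]
      simp only [e, t]
      push_cast
      ring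
    rw [hz1, hz2, he]
    ring
  obtain ⟨C, hC⟩ := exists_bound_mul_deriv_smoothTransition
  obtain ⟨C1, hC1⟩ := exists_bound_on_disc (hDq.add hDqb)
  obtain ⟨C2, hC2⟩ := exists_bound_on_disc hr
  have hcut : ∀ j z, ‖cutoff j z‖ ≤ 1 := by
    intro j z
    rw [cutoff, Complex.norm_real, Real.norm_of_nonneg (Real.smoothTransition.nonneg _)]
    exact Real.smoothTransition.le_one _
  have hcut1 : ∀ z ∈ unitDisc, ∀ᶠ j : ℕ in atTop, cutoff (j + 1) z = 1 ∧ e j z = 0 := by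
    intro z hz
    filter_upwards [(tendsto_cutoff_arg hz).eventually_gt_atTop 1] with j hj
    refine ⟨?_, ?_⟩
    · rw [cutoff, Real.smoothTransition.one_of_one_le hj.le, Complex.ofReal_one]
    · change (((t j z + 1) * deriv s (t j z) : ℝ) : ℂ) = 0
      rw [deriv_smoothTransition_of_one_lt hj]
      simp
  have iL : Integrable (fun z => g z * q z + gb z * qb z) discMeasure :=
    (integrable_mul_continuous hg hq.continuous).add
      (integrable_mul_continuous hgb hqb.continuous)
  have limL : Tendsto (fun j : ℕ => ∫ z, (g z * q z + gb z * qb z) * cutoff (j + 1) z ∂discMeasure)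
      atTop (𝓝 (∫ z, (g z * q z + gb z * qb z) ∂discMeasure)) := by
    refine tendsto_integral_of_dominated_convergence
      (fun z => ‖g z * q z + gb z * qb z‖) (fun j => ?_) iL.norm (fun j => ?_) ?_
    · exact iL.1.mul (hcc _).aestronglyMeasurable
    · refine Eventually.of_forall fun z => ?_
      rw [norm_mul]
      exact mul_le_of_le_one_right (norm_nonneg _) (hcut _ _)
    · filter_upwards [ae_mem_unitDisc] with z hz
      refine tendsto_const_nhds.congr' ?_
      filter_upwards [hcut1 z hz] with j hj
      rw [hj.1, mul_one]
  have limR : Tendsto (fun j : ℕ => ∫ z, u z * (cutoff (j + 1) z * (wirt (-Complex.I) q z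
        + wirt Complex.I qb z) - e j z * r z) ∂discMeasure)
      atTop (𝓝 (∫ z, u z * (wirt (-Complex.I) q z + wirt Complex.I qb z) ∂discMeasure)) := by
    refine tendsto_integral_of_dominated_convergence
      (fun z => ‖u z‖ * (C1 + C * C2)) (fun j => ?_)
      ((hu.integrable (by norm_num)).norm.mul_const _) (fun j => ?_) ?_
    · exact hu.1.mul (((hcc _).mul (hDq.add hDqb)).sub
        ((hec j).mul hr)).aestronglyMeasurable
    · filter_upwards [ae_mem_unitDisc] with z hz
      rw [norm_mul]
      refine mul_le_mul_of_nonneg_left ((norm_sub_le _ _).trans (add_le_add ?_ ?_)) (norm_nonneg _)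
      · rw [norm_mul]
        exact (mul_le_of_le_one_left (norm_nonneg _) (hcut _ _)).trans (hC1 z hz)
      · rw [norm_mul]
        refine mul_le_mul ?_ (hC2 z hz) (norm_nonneg _) ((abs_nonneg _).trans (hC 0))
        simp only [e, Complex.norm_real]
        exact hC _
    · filter_upwards [ae_mem_unitDisc] with z hz
      refine tendsto_const_nhds.congr' ?_
      filter_upwards [hcut1 z hz] with j hj
      rw [hj.1, hj.2, one_mul, zero_mul, sub_zero]
  refine tendsto_nhds_unique limL ?_
  simp_rw [key]
  exact limR.neg

/-! ### Functions with weak derivatives up to a given order -/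

/-- The function `u` is square-integrable on the disc, with all its weak derivatives of order at
most `j`. -/
def HasWeakDerivs : ℕ → (ℂ → ℂ) → Prop
  | 0, u => MemLp u 2 discMeasure
  | j + 1, u => MemLp u 2 discMeasure ∧ ∀ c : ℂ, ∃ g, HasWeakDerivs j g ∧ IsWeakWirt c u g

lemma HasWeakDerivs.memLp {j : ℕ} {u : ℂ → ℂ} (h : HasWeakDerivs j u) : MemLp u 2 discMeasure := by
  cases j with
  | zero => exact h
  | succ j => exact h.1

lemma HasWeakDerivs.of_succ {j : ℕ} {u : ℂ → ℂ} (h : HasWeakDerivs (j + 1) u) :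
    HasWeakDerivs j u := by
  induction j generalizing u with
  | zero => exact h.1
  | succ j ih =>
    refine ⟨h.1, fun c => ?_⟩
    obtain ⟨g, hg, hug⟩ := h.2 c
    exact ⟨g, ih hg, hug⟩

lemma IsTestFunction.continuous {φ : ℂ → ℂ} (h : IsTestFunction φ) : Continuous φ :=
  h.smooth.continuous

lemma IsTestFunction.mul_smooth {φ f : ℂ → ℂ} (h : IsTestFunction φ) (hf : ContDiff ℝ ∞ f) :
    IsTestFunction (fun z => f z * φ z) :=
  ⟨hf.mul h.smooth, h.compact.mul_left,
    (closure_mono (Function.support_mul_subset_right f φ)).trans h.support⟩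

lemma HasWeakDerivs.add {j : ℕ} {u v : ℂ → ℂ} (hu : HasWeakDerivs j u) (hv : HasWeakDerivs j v) :
    HasWeakDerivs j (fun z => u z + v z) := by
  induction j generalizing u v with
  | zero => exact MemLp.add (f := u) (g := v) hu hv
  | succ j ih =>
    refine ⟨MemLp.add (f := u) (g := v) hu.1 hv.1, fun c => ?_⟩
    obtain ⟨g, hg, hug⟩ := hu.2 c
    obtain ⟨h, hh, hvh⟩ := hv.2 c
    refine ⟨_, ih hg hh, fun φ hφ => ?_⟩
    have hc := (contDiff_wirt c hφ.smooth).continuous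
    simp_rw [add_mul]
    rw [integral_add (integrable_mul_continuous hu.1 hc) (integrable_mul_continuous hv.1 hc),
      integral_add (integrable_mul_continuous hg.memLp hφ.continuous)
        (integrable_mul_continuous hh.memLp hφ.continuous), hug φ hφ, hvh φ hφ]
    ring

lemma HasWeakDerivs.mul_smooth {j : ℕ} {u f : ℂ → ℂ} (hu : HasWeakDerivs j u)
    (hf : ContDiff ℝ ∞ f) : HasWeakDerivs j (fun z => u z * f z) := by
  induction j generalizing u f with
  | zero => exact memLp_mul_continuous hu hf.continuous
  | succ j ih =>
    refine ⟨memLp_mul_continuous hu.1 hf.continuous, fun c => ?_⟩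
    obtain ⟨g, hg, hug⟩ := hu.2 c
    have hfc := contDiff_wirt c hf
    refine ⟨_, (ih hg hf).add (ih hu.of_succ hfc), fun φ hφ => ?_⟩
    have h1 := hug _ (hφ.mul_smooth hf)
    have hd : ∀ f : ℂ → ℂ, ContDiff ℝ ∞ f → ∀ z, DifferentiableAt ℝ f z :=
      fun f hf z => hf.differentiable (by simp) z
    have hφc := (contDiff_wirt c hφ.smooth).continuous
    have i1 : Integrable (fun z => u z * (f z * wirt c φ z)) discMeasure :=
      integrable_mul_continuous hu.1 (hf.continuous.mul hφc)
    have i2 : Integrable (fun z => u z * (wirt c f z * φ z)) discMeasure :=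
      integrable_mul_continuous hu.1 (hfc.continuous.mul hφ.continuous)
    have i3 : Integrable (fun z => g z * (f z * φ z)) discMeasure :=
      integrable_mul_continuous hg.memLp (hf.continuous.mul hφ.continuous)
    have e1 : ∫ z, u z * wirt c (fun z => f z * φ z) z ∂discMeasure
        = ∫ z, u z * (f z * wirt c φ z) ∂discMeasure
          + ∫ z, u z * (wirt c f z * φ z) ∂discMeasure := by
      rw [← integral_add i1 i2]
      congr 1
      ext z
      rw [wirt_mul c (hd f hf z) (hd φ hφ.smooth z)]
      ring
    have e2 : ∫ z, (g z * f z + u z * wirt c f z) * φ z ∂discMeasure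
        = ∫ z, g z * (f z * φ z) ∂discMeasure + ∫ z, u z * (wirt c f z * φ z) ∂discMeasure := by
      rw [← integral_add i3 i2]
      congr 1
      ext z
      ring
    have e3 : ∀ z, u z * f z * wirt c φ z = u z * (f z * wirt c φ z) := fun z => by ring
    simp_rw [e3]
    rw [e2]
    linear_combination h1 - e1

lemma isWeakWirt_of_smooth (c : ℂ) {f : ℂ → ℂ} (hf : ContDiff ℝ ∞ f) :
    IsWeakWirt c f (wirt c f) := by
  intro φ hφ
  -- the test function vanishes off the disc, so that the integrals may be taken over the plane
  have hout : ∀ (a b : ℂ → ℂ), tsupport b ⊆ unitDisc →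
      ∫ z, a z * b z ∂discMeasure
        = ((ENNReal.ofReal Real.pi)⁻¹).toReal • ∫ z, a z * b z := by
    intro a b hb
    rw [discMeasure, integral_smul_measure, setIntegral_eq_integral_of_forall_compl_eq_zero]
    intro z hz
    rw [image_eq_zero_of_notMem_tsupport fun h => hz (hb h), mul_zero]
  have hdir : ∀ v : ℂ, ∫ z, f z * fderiv ℝ φ z v = -∫ z, fderiv ℝ f z v * φ z := by
    intro v
    have hfv : ContDiff ℝ ∞ (fun z => fderiv ℝ f z v) :=
      (hf.fderiv_right (m := ∞) (by simp)).clm_apply contDiff_const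
    have hφv := smooth_step v ⟨hφ.smooth, hφ.compact⟩
    refine integral_mul_fderiv_eq_neg_fderiv_mul_of_integrable ?_ ?_ ?_
      (fun x _ => hf.differentiable (by simp) x) (fun x _ => hφ.smooth.differentiable (by simp) x)
    · exact (hfv.continuous.mul hφ.continuous).integrable_of_hasCompactSupport hφ.compact.mul_left
    · exact (hf.continuous.mul hφv.1.continuous).integrable_of_hasCompactSupport hφv.2.mul_left
    · exact (hf.continuous.mul hφ.continuous).integrable_of_hasCompactSupport hφ.compact.mul_left
  have hts : tsupport (wirt c φ) ⊆ unitDisc := by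
    refine (closure_minimal ?_ (isClosed_tsupport φ)).trans hφ.support
    intro z hz
    by_contra h
    apply hz
    have : fderiv ℝ φ z = 0 := by
      by_contra h'
      exact h (support_fderiv_subset ℝ h')
    simp [wirt, this]
  rw [hout _ _ hts, hout _ _ hφ.support, ← smul_neg]
  congr 1
  have j1 : ∀ v : ℂ, Integrable (fun z => f z * fderiv ℝ φ z v) := fun v =>
    (hf.continuous.mul (smooth_step v ⟨hφ.smooth, hφ.compact⟩).1.continuous
      ).integrable_of_hasCompactSupport (smooth_step v ⟨hφ.smooth, hφ.compact⟩).2.mul_left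
  have j2 : ∀ v : ℂ, Integrable (fun z => fderiv ℝ f z v * φ z) := fun v =>
    ((((hf.fderiv_right (m := ∞) (by simp)).clm_apply contDiff_const).continuous.mul
      hφ.continuous)).integrable_of_hasCompactSupport hφ.compact.mul_left
  have e1 : ∫ z, f z * wirt c φ z = (1 / 2) * (∫ z, f z * fderiv ℝ φ z 1)
      + (c / 2) * (∫ z, f z * fderiv ℝ φ z Complex.I) := by
    rw [← integral_const_mul, ← integral_const_mul,
      ← integral_add ((j1 _).const_mul _) ((j1 _).const_mul _)]
    congr 1
    ext z
    rw [wirt]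
    ring
  have e2 : ∫ z, wirt c f z * φ z = (1 / 2) * (∫ z, fderiv ℝ f z 1 * φ z)
      + (c / 2) * (∫ z, fderiv ℝ f z Complex.I * φ z) := by
    rw [← integral_const_mul, ← integral_const_mul,
      ← integral_add ((j2 _).const_mul _) ((j2 _).const_mul _)]
    congr 1
    ext z
    rw [wirt]
    ring
  rw [e1, e2, hdir, hdir]
  ring

/-! ### Polynomials in `z` and its conjugate -/

/-- The function `z ↦ P(z, conj z)`. -/
def polyFun (P : MvPolynomial (Fin 2) ℂ) (z : ℂ) : ℂ := MvPolynomial.eval ![z, star z] P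

open MvPolynomial in
lemma polyFun_X_zero (z : ℂ) : polyFun (X 0) z = z := by simp [polyFun]

open MvPolynomial in
lemma polyFun_X_one (z : ℂ) : polyFun (X 1) z = star z := by simp [polyFun]

open MvPolynomial in
lemma polyFun_C (a z : ℂ) : polyFun (C a) z = a := by simp [polyFun]

lemma polyFun_add (P Q : MvPolynomial (Fin 2) ℂ) (z : ℂ) :
    polyFun (P + Q) z = polyFun P z + polyFun Q z := by simp [polyFun]

lemma polyFun_sub (P Q : MvPolynomial (Fin 2) ℂ) (z : ℂ) :
    polyFun (P - Q) z = polyFun P z - polyFun Q z := by simp [polyFun]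

lemma polyFun_neg (P : MvPolynomial (Fin 2) ℂ) (z : ℂ) :
    polyFun (-P) z = -polyFun P z := by simp [polyFun]

lemma polyFun_mul (P Q : MvPolynomial (Fin 2) ℂ) (z : ℂ) :
    polyFun (P * Q) z = polyFun P z * polyFun Q z := by simp [polyFun]

lemma polyFun_pow (P : MvPolynomial (Fin 2) ℂ) (n : ℕ) (z : ℂ) :
    polyFun (P ^ n) z = polyFun P z ^ n := by simp [polyFun]

lemma polyFun_smul (a : ℂ) (P : MvPolynomial (Fin 2) ℂ) (z : ℂ) :
    polyFun (a • P) z = a * polyFun P z := by simp [polyFun]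

lemma polyFun_sum {ι : Type*} (s : Finset ι) (P : ι → MvPolynomial (Fin 2) ℂ) (z : ℂ) :
    polyFun (∑ i ∈ s, P i) z = ∑ i ∈ s, polyFun (P i) z := by simp [polyFun]

open MvPolynomial in
lemma contDiff_polyFun (P : MvPolynomial (Fin 2) ℂ) : ContDiff ℝ ∞ (polyFun P) := by
  induction P using MvPolynomial.induction_on with
  | C a =>
    have : polyFun (C a) = fun _ => a := funext (polyFun_C a)
    rw [this]
    exact contDiff_const
  | add P Q hP hQ =>
    have : polyFun (P + Q) = fun z => polyFun P z + polyFun Q z := funext (polyFun_add P Q)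
    rw [this]
    exact hP.add hQ
  | mul_X P i hP =>
    have : polyFun (P * X i) = fun z => polyFun P z * polyFun (X i) z := funext (polyFun_mul P _)
    rw [this]
    refine hP.mul ?_
    fin_cases i
    · exact (funext polyFun_X_zero : polyFun (X 0) = fun z => z) ▸ contDiff_id
    · exact (funext polyFun_X_one : polyFun (X 1) = fun z => Complex.conjCLE z) ▸
        Complex.conjCLE.contDiff

lemma differentiableAt_polyFun (P : MvPolynomial (Fin 2) ℂ) (z : ℂ) :
    DifferentiableAt ℝ (polyFun P) z :=
  (contDiff_polyFun P).differentiable (by simp) z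

lemma continuous_polyFun (P : MvPolynomial (Fin 2) ℂ) : Continuous (polyFun P) :=
  (contDiff_polyFun P).continuous

lemma wirt_add (c : ℂ) {f g : ℂ → ℂ} {z : ℂ} (hf : DifferentiableAt ℝ f z)
    (hg : DifferentiableAt ℝ g z) :
    wirt c (fun z => f z + g z) z = wirt c f z + wirt c g z := by
  have h := fderiv_fun_add hf hg
  simp only [wirt, h, add_apply]
  ring

open MvPolynomial in
lemma wirt_polyFun_of_X (c : ℂ) (i : Fin 2)
    (hX : ∀ j z, wirt c (polyFun (X j)) z = polyFun (pderiv i (X j)) z)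
    (P : MvPolynomial (Fin 2) ℂ) (z : ℂ) :
    wirt c (polyFun P) z = polyFun (pderiv i P) z := by
  induction P using MvPolynomial.induction_on with
  | C a =>
    have : polyFun (C a) = fun _ => a := funext (polyFun_C a)
    rw [this]
    simp [wirt, polyFun]
  | add P Q hP hQ =>
    have : polyFun (P + Q) = fun z => polyFun P z + polyFun Q z := funext (polyFun_add P Q)
    rw [this, wirt_add c (differentiableAt_polyFun P z) (differentiableAt_polyFun Q z), hP, hQ,
      map_add, polyFun_add]
  | mul_X P j hP =>
    have : polyFun (P * X j) = fun z => polyFun P z * polyFun (X j) z := funext (polyFun_mul P _)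
    rw [this, wirt_mul c (differentiableAt_polyFun P z) (differentiableAt_polyFun _ z), hP, hX,
      Derivation.leibniz, polyFun_add, smul_eq_mul, smul_eq_mul, polyFun_mul, polyFun_mul]
    ring

open MvPolynomial in
lemma wirt_X (c : ℂ) (z : ℂ) : wirt c (polyFun (X 0)) z = (1 + c * Complex.I) / 2
    ∧ wirt c (polyFun (X 1)) z = (1 - c * Complex.I) / 2 := by
  have h0 : polyFun (X 0) = fun z => z := funext polyFun_X_zero
  have h1 : polyFun (X 1) = fun z => Complex.conjCLE z := funext polyFun_X_one
  constructor
  · rw [h0, wirt, fderiv_fun_id]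
    simp
  · rw [h1, wirt, Complex.conjCLE.fderiv]
    simp
    ring

open MvPolynomial in
/-- The operator `∂` acts on polynomials as the formal derivative in the first variable. -/
lemma wirt_polyFun_zero (P : MvPolynomial (Fin 2) ℂ) (z : ℂ) :
    wirt (-Complex.I) (polyFun P) z = polyFun (pderiv 0 P) z := by
  refine wirt_polyFun_of_X _ _ (fun j z => ?_) P z
  fin_cases j
  · simp [(wirt_X _ z).1, polyFun]
  · simp [(wirt_X _ z).2, polyFun, pderiv_X]

open MvPolynomial in
/-- The operator `∂bar` acts on polynomials as the formal derivative in the second variable. -/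
lemma wirt_polyFun_one (P : MvPolynomial (Fin 2) ℂ) (z : ℂ) :
    wirt Complex.I (polyFun P) z = polyFun (pderiv 1 P) z := by
  refine wirt_polyFun_of_X _ _ (fun j z => ?_) P z
  fin_cases j
  · simp [(wirt_X _ z).1, polyFun, pderiv_X]
  · simp [(wirt_X _ z).2, polyFun]

/-! ### The Zernike operator -/

open MvPolynomial in
/-- For `(i, j) = (0, 1)` the polynomial `z² ∂P - (2 - |z|²) ∂bar P`, for `(i, j) = (1, 0)` the
polynomial `conj(z)² ∂bar P - (2 - |z|²) ∂P`. These are the components of a vector field tangent to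
the circle, whose divergence is the Zernike operator applied to `P`. -/
def zernikeField (i j : Fin 2) : MvPolynomial (Fin 2) ℂ →ₗ[ℂ] MvPolynomial (Fin 2) ℂ :=
  LinearMap.mulLeft ℂ (X i ^ 2) ∘ₗ (pderiv i).toLinearMap
    - LinearMap.mulLeft ℂ (2 - X 0 * X 1) ∘ₗ (pderiv j).toLinearMap

open MvPolynomial in
/-- The Zernike operator `-∂_x (1 - |z|²) ∂_x - ∂_y (1 - |z|²) ∂_y - ∂_θ²`, written as
`∂ (z² ∂ - (2 - |z|²) ∂bar) + ∂bar (conj(z)² ∂bar - (2 - |z|²) ∂)`. -/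
def zernikeOp : MvPolynomial (Fin 2) ℂ →ₗ[ℂ] MvPolynomial (Fin 2) ℂ :=
  (pderiv 0).toLinearMap ∘ₗ zernikeField 0 1 + (pderiv 1).toLinearMap ∘ₗ zernikeField 1 0

open MvPolynomial in
/-- The operator `z ∂ - conj(z) ∂bar = -i ∂_θ`. -/
def rotOp : MvPolynomial (Fin 2) ℂ →ₗ[ℂ] MvPolynomial (Fin 2) ℂ :=
  LinearMap.mulLeft ℂ (X 0) ∘ₗ (pderiv 0).toLinearMap
    - LinearMap.mulLeft ℂ (X 1) ∘ₗ (pderiv 1).toLinearMap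

open MvPolynomial in
lemma zernikeField_apply (i j : Fin 2) (P : MvPolynomial (Fin 2) ℂ) :
    zernikeField i j P = X i ^ 2 * pderiv i P - (2 - X 0 * X 1) * pderiv j P := rfl

open MvPolynomial in
lemma zernikeOp_apply (P : MvPolynomial (Fin 2) ℂ) :
    zernikeOp P = pderiv 0 (zernikeField 0 1 P) + pderiv 1 (zernikeField 1 0 P) := rfl

open MvPolynomial in
lemma rotOp_apply (P : MvPolynomial (Fin 2) ℂ) :
    rotOp P = X 0 * pderiv 0 P - X 1 * pderiv 1 P := rfl

lemma normSq_eq_mul_star (z : ℂ) : (Complex.normSq z : ℂ) = z * star z :=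
  (Complex.mul_conj z).symm

open MvPolynomial in
/-- The tangential integration by parts for polynomial vector fields. -/
lemma integral_weakWirt_mul_polyFun {u g gb : ℂ → ℂ} (hu : MemLp u 2 discMeasure)
    (hg : MemLp g 2 discMeasure) (hgb : MemLp gb 2 discMeasure)
    (hug : IsWeakWirt (-Complex.I) u g) (hugb : IsWeakWirt Complex.I u gb)
    {Q Qb R : MvPolynomial (Fin 2) ℂ} (h : X 1 * Q + X 0 * Qb = (1 - X 0 * X 1) * R) :
    ∫ z, (g z * polyFun Q z + gb z * polyFun Qb z) ∂discMeasure
      = -∫ z, u z * polyFun (pderiv 0 Q + pderiv 1 Qb) z ∂discMeasure := by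
  rw [integral_weakWirt_mul_tangent hu hg hgb hug hugb (contDiff_polyFun Q) (contDiff_polyFun Qb)
    (continuous_polyFun R)]
  · simp_rw [wirt_polyFun_zero, wirt_polyFun_one, polyFun_add]
  · intro z
    have := congrArg (fun P => polyFun P z) h
    simp only [polyFun_add, polyFun_mul, polyFun_sub, polyFun_X_zero, polyFun_X_one] at this
    rw [this, normSq_eq_mul_star]
    simp [polyFun]

open MvPolynomial in
/-- The Zernike operator in weak form: one integration by parts. -/
lemma integral_mul_zernikeOp {u g gb : ℂ → ℂ} (hu : MemLp u 2 discMeasure)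
    (hg : MemLp g 2 discMeasure) (hgb : MemLp gb 2 discMeasure)
    (hug : IsWeakWirt (-Complex.I) u g) (hugb : IsWeakWirt Complex.I u gb)
    (P : MvPolynomial (Fin 2) ℂ) :
    ∫ z, u z * polyFun (zernikeOp P) z ∂discMeasure
      = -∫ z, (g z * polyFun (zernikeField 0 1 P) z + gb z * polyFun (zernikeField 1 0 P) z)
        ∂discMeasure := by
  rw [integral_weakWirt_mul_polyFun hu hg hgb hug hugb
    (R := -2 * (X 0 * pderiv 0 P + X 1 * pderiv 1 P)), neg_neg, zernikeOp_apply]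
  rw [zernikeField_apply, zernikeField_apply]
  ring

lemma integral_polyFun_mul_zernikeOp (F G : MvPolynomial (Fin 2) ℂ) :
    ∫ z, polyFun F z * polyFun (zernikeOp G) z ∂discMeasure
      = ∫ z, polyFun (zernikeOp F) z * polyFun G z ∂discMeasure := by
  have key : ∀ F G : MvPolynomial (Fin 2) ℂ,
      ∫ z, polyFun F z * polyFun (zernikeOp G) z ∂discMeasure
        = -∫ z, (polyFun (MvPolynomial.pderiv 0 F) z * polyFun (zernikeField 0 1 G) z
          + polyFun (MvPolynomial.pderiv 1 F) z * polyFun (zernikeField 1 0 G) z)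
          ∂discMeasure := by
    intro F G
    have h0 : wirt (-Complex.I) (polyFun F) = polyFun (MvPolynomial.pderiv 0 F) :=
      funext (wirt_polyFun_zero F)
    have h1 : wirt Complex.I (polyFun F) = polyFun (MvPolynomial.pderiv 1 F) :=
      funext (wirt_polyFun_one F)
    exact integral_mul_zernikeOp (memLp_of_continuous (continuous_polyFun F))
      (memLp_of_continuous (continuous_polyFun _)) (memLp_of_continuous (continuous_polyFun _))
      (h0 ▸ isWeakWirt_of_smooth _ (contDiff_polyFun F))
      (h1 ▸ isWeakWirt_of_smooth _ (contDiff_polyFun F)) G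
  simp_rw [mul_comm (polyFun (zernikeOp F) _)]
  rw [key, key]
  congr 2
  ext z
  simp only [zernikeField_apply, polyFun_sub, polyFun_mul]
  ring

open MvPolynomial in
lemma integral_polyFun_mul_rotOp (F G : MvPolynomial (Fin 2) ℂ) :
    ∫ z, polyFun F z * polyFun (rotOp G) z ∂discMeasure
      = -∫ z, polyFun (rotOp F) z * polyFun G z ∂discMeasure := by
  have h0 : wirt (-Complex.I) (polyFun F) = polyFun (pderiv 0 F) := funext (wirt_polyFun_zero F)
  have h1 : wirt Complex.I (polyFun F) = polyFun (pderiv 1 F) := funext (wirt_polyFun_one F)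
  have h := integral_weakWirt_mul_polyFun (memLp_of_continuous (continuous_polyFun F))
      (memLp_of_continuous (continuous_polyFun _)) (memLp_of_continuous (continuous_polyFun _))
      (h0 ▸ isWeakWirt_of_smooth _ (contDiff_polyFun F))
      (h1 ▸ isWeakWirt_of_smooth _ (contDiff_polyFun F))
      (Q := X 0 * G) (Qb := -(X 1 * G)) (R := 0) (by ring)
  have e : pderiv 0 (X 0 * G) + pderiv 1 (-(X 1 * G)) = rotOp G := by
    simp only [rotOp_apply, Derivation.leibniz, map_neg, pderiv_X_self, smul_eq_mul]
    ring
  rw [e, eq_comm, neg_eq_iff_eq_neg] at h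
  rw [h]
  congr 2
  ext z
  simp only [rotOp_apply, polyFun_sub, polyFun_mul, polyFun_neg]
  ring

open MvPolynomial in
/-- The Zernike operator maps a function with `j + 2` weak derivatives to one with `j`. Its
coefficients of second order degenerate on the circle in the normal direction, whence the absence
of boundary terms. -/
theorem exists_weak_zernikeOp {j : ℕ} {u : ℂ → ℂ} (hu : HasWeakDerivs (j + 2) u) :
    ∃ g, HasWeakDerivs j g ∧ ∀ P : MvPolynomial (Fin 2) ℂ,
      ∫ z, g z * polyFun P z ∂discMeasure = ∫ z, u z * polyFun (zernikeOp P) z ∂discMeasure := by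
  obtain ⟨a, ha, hua⟩ := hu.2 (-Complex.I)
  obtain ⟨b, hb, hub⟩ := hu.2 Complex.I
  obtain ⟨aa, haa, haa'⟩ := ha.2 (-Complex.I)
  obtain ⟨ab, hab, hab'⟩ := ha.2 Complex.I
  obtain ⟨ba, hba, hba'⟩ := hb.2 (-Complex.I)
  obtain ⟨bb, hbb, hbb'⟩ := hb.2 Complex.I
  have hs := fun P => contDiff_polyFun P
  refine ⟨fun z => ((aa z * polyFun (X 0 ^ 2) z + ab z * polyFun (-(2 - X 0 * X 1)) z)
      + a z * polyFun (3 * X 0) z)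
      + ((bb z * polyFun (X 1 ^ 2) z + ba z * polyFun (-(2 - X 0 * X 1)) z)
      + b z * polyFun (3 * X 1) z),
    (((haa.mul_smooth (hs _)).add (hab.mul_smooth (hs _))).add
      (ha.of_succ.mul_smooth (hs _))).add
    (((hbb.mul_smooth (hs _)).add (hba.mul_smooth (hs _))).add
      (hb.of_succ.mul_smooth (hs _))), fun P => ?_⟩
  have h1 := integral_weakWirt_mul_polyFun ha.memLp haa.memLp hab.memLp haa' hab'
    (Q := -(X 0 ^ 2 * P)) (Qb := (2 - X 0 * X 1) * P) (R := 2 * X 0 * P) (by ring)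
  have h2 := integral_weakWirt_mul_polyFun hb.memLp hba.memLp hbb.memLp hba' hbb'
    (Q := (2 - X 0 * X 1) * P) (Qb := -(X 1 ^ 2 * P)) (R := 2 * X 1 * P) (by ring)
  have e1 : pderiv 0 (-(X 0 ^ 2 * P)) + pderiv 1 ((2 - X 0 * X 1) * P)
      = -zernikeField 0 1 P - 3 * X 0 * P := by
    have h2 : ∀ i : Fin 2, pderiv i (2 : MvPolynomial (Fin 2) ℂ) = 0 := fun i => by
      exact (pderiv i).map_natCast 2
    have h10 : pderiv (1 : Fin 2) (X 0 : MvPolynomial (Fin 2) ℂ) = 0 :=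
      pderiv_X_of_ne (by decide)
    simp only [zernikeField_apply, Derivation.leibniz, Derivation.leibniz_pow, map_neg, map_sub,
      pderiv_X_self, h2, h10, smul_eq_mul, nsmul_eq_mul]
    push_cast
    ring
  have e2 : pderiv 0 ((2 - X 0 * X 1) * P) + pderiv 1 (-(X 1 ^ 2 * P))
      = -zernikeField 1 0 P - 3 * X 1 * P := by
    have h2 : ∀ i : Fin 2, pderiv i (2 : MvPolynomial (Fin 2) ℂ) = 0 := fun i => by
      exact (pderiv i).map_natCast 2
    have h01 : pderiv (0 : Fin 2) (X 1 : MvPolynomial (Fin 2) ℂ) = 0 :=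
      pderiv_X_of_ne (by decide)
    simp only [zernikeField_apply, Derivation.leibniz, Derivation.leibniz_pow, map_neg, map_sub,
      pderiv_X_self, h2, h01, smul_eq_mul, nsmul_eq_mul]
    push_cast
    ring
  rw [e1] at h1
  rw [e2] at h2
  rw [integral_mul_zernikeOp hu.memLp ha.memLp hb.memLp hua hub P]
  have hi : ∀ {f : ℂ → ℂ}, MemLp f 2 discMeasure → ∀ P, Integrable (fun z => f z * polyFun P z)
      discMeasure := fun hf P => integrable_mul_continuous hf (continuous_polyFun P)
  have iA := (hi haa.memLp (-(X 0 ^ 2 * P))).add (hi hab.memLp ((2 - X 0 * X 1) * P))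
  have iA' := hi ha.memLp (-zernikeField 0 1 P - 3 * X 0 * P)
  have iB := (hi hba.memLp ((2 - X 0 * X 1) * P)).add (hi hbb.memLp (-(X 1 ^ 2 * P)))
  have iB' := hi hb.memLp (-zernikeField 1 0 P - 3 * X 1 * P)
  have iS := (hi ha.memLp (zernikeField 0 1 P)).add (hi hb.memLp (zernikeField 1 0 P))
  have hsum := integral_sub ((iA.add iA').add (iB.add iB')).neg iS
  rw [integral_neg', integral_add' (iA.add iA') (iB.add iB'), integral_add' iA iA',
    integral_add' iB iB'] at hsum
  simp only [Pi.add_apply, Pi.neg_apply] at hsum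
  rw [h1, h2, neg_add_cancel, neg_add_cancel, add_zero, neg_zero, zero_sub] at hsum
  rw [← hsum]
  congr 1
  ext z
  simp only [polyFun_sub, polyFun_mul, polyFun_neg, polyFun_pow]
  ring

/-! ### Sobolev functions and powers of the Zernike operator -/

lemma partialDeriv_comp_one {φ : ℂ → ℂ} (α : ℕ × ℕ) (hφ : ContDiff ℝ ∞ φ) :
    partialDeriv α (fun z => fderiv ℝ φ z 1) = partialDeriv (α.1 + 1, α.2) φ := by
  have hsm : ∀ (ψ : ℂ → ℂ) (w : ℂ), ContDiff ℝ ∞ ψ → ContDiff ℝ ∞ (fun z => fderiv ℝ ψ z w) :=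
    fun ψ w h => (h.fderiv_right (m := ∞) (by simp)).clm_apply contDiff_const
  have hcomm : ∀ ψ : ℂ → ℂ, ContDiff ℝ ∞ ψ →
      (fun z => fderiv ℝ (fun z => fderiv ℝ ψ z 1) z Complex.I)
        = fun z => fderiv ℝ (fun z => fderiv ℝ ψ z Complex.I) z 1 := by
    intro ψ hψ
    ext z
    have hd : DifferentiableAt ℝ (fderiv ℝ ψ) z :=
      (hψ.fderiv_right (m := ∞) (by simp)).differentiable (by simp) z
    rw [fderiv_clm_apply hd (differentiableAt_const _),
      fderiv_clm_apply hd (differentiableAt_const _)]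
    simpa using ((contDiff_infty.1 hψ 2).contDiffAt.isSymmSndFDerivAt (by simp)) Complex.I 1
  have key : ∀ (b : ℕ) (ψ : ℂ → ℂ), ContDiff ℝ ∞ ψ →
      (fun ψ z => fderiv ℝ ψ z Complex.I)^[b] (fun z => fderiv ℝ ψ z 1)
        = fun z => fderiv ℝ ((fun ψ z => fderiv ℝ ψ z Complex.I)^[b] ψ) z 1 := by
    intro b
    induction b with
    | zero => intro ψ _; rfl
    | succ b ih =>
      intro ψ hψ
      rw [Function.iterate_succ_apply, Function.iterate_succ_apply, hcomm ψ hψ]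
      exact ih _ (hsm _ _ hψ)
  unfold partialDeriv
  rw [key _ _ hφ, Function.iterate_succ_apply]

lemma partialDeriv_comp_I {φ : ℂ → ℂ} (α : ℕ × ℕ) :
    partialDeriv α (fun z => fderiv ℝ φ z Complex.I) = partialDeriv (α.1, α.2 + 1) φ := by
  unfold partialDeriv
  rw [Function.iterate_succ_apply]

/-- Test functions are stable under directional derivatives. -/
lemma IsTestFunction.fderiv_apply {φ : ℂ → ℂ} (h : IsTestFunction φ) (w : ℂ) :
    IsTestFunction (fun z => fderiv ℝ φ z w) := by
  obtain ⟨h1, h2⟩ := smooth_step w ⟨h.smooth, h.compact⟩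
  exact ⟨h1, h2, (tsupport_fderiv_apply_subset ℝ w).trans h.support⟩

/-- The entries of a jet are weak derivatives of one another. -/
lemma hasWeakDerivs_jet {m : ℕ} (U : HNat m) (j : ℕ) (α : ℕ × ℕ) (hα : α.1 + α.2 + j ≤ m) :
    HasWeakDerivs j ((U : PiLp 2 fun _ : multiIndices m => L2Disc)
      ⟨α, mem_multiIndices.2 (by omega)⟩ : L2Disc) := by
  induction j generalizing α with
  | zero => exact Lp.memLp _
  | succ j ih =>
    refine ⟨Lp.memLp _, fun c => ?_⟩
    have hx := ih (α.1 + 1, α.2) (by simp only; omega)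
    have hy := ih (α.1, α.2 + 1) (by simp only; omega)
    refine ⟨_, (hx.mul_smooth (f := fun _ => 1 / 2) contDiff_const).add
      (hy.mul_smooth (f := fun _ => c / 2) contDiff_const), fun φ hφ => ?_⟩
    have d0 := U.2 ⟨α, mem_multiIndices.2 (by omega)⟩
    have d1 := U.2 ⟨(α.1 + 1, α.2), mem_multiIndices.2 (by simp only; omega)⟩ φ hφ
    have d2 := U.2 ⟨(α.1, α.2 + 1), mem_multiIndices.2 (by simp only; omega)⟩ φ hφ
    have d01 := d0 _ (hφ.fderiv_apply 1)
    have d02 := d0 _ (hφ.fderiv_apply Complex.I)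
    simp only at d1 d2 d01 d02
    rw [partialDeriv_comp_one α hφ.smooth] at d01
    rw [partialDeriv_comp_I α] at d02
    rw [d01] at d1
    rw [d02] at d2
    have hne : ((-1 : ℂ) ^ (α.1 + α.2)) ≠ 0 := by simp
    have e1 : ((-1 : ℂ) ^ (α.1 + 1 + α.2)) = (-1) ^ (α.1 + α.2) * (-1) := by ring
    have e2 : ((-1 : ℂ) ^ (α.1 + (α.2 + 1))) = (-1) ^ (α.1 + α.2) * (-1) := by ring
    rw [e1, mul_assoc] at d1
    rw [e2, mul_assoc] at d2
    have d1' := mul_left_cancel₀ hne d1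
    have d2' := mul_left_cancel₀ hne d2
    set u : L2Disc := (U : PiLp 2 fun _ : multiIndices m => L2Disc)
      ⟨α, mem_multiIndices.2 (by omega)⟩
    set ux : L2Disc := (U : PiLp 2 fun _ : multiIndices m => L2Disc)
      ⟨(α.1 + 1, α.2), mem_multiIndices.2 (by simp only; omega)⟩
    set uy : L2Disc := (U : PiLp 2 fun _ : multiIndices m => L2Disc)
      ⟨(α.1, α.2 + 1), mem_multiIndices.2 (by simp only; omega)⟩
    have i1 := (integrable_mul_continuous (Lp.memLp u) (hφ.fderiv_apply 1).continuous).const_mul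
      (1 / 2)
    have i2 := (integrable_mul_continuous (Lp.memLp u)
      (hφ.fderiv_apply Complex.I).continuous).const_mul (c / 2)
    have i3 := (integrable_mul_continuous hx.memLp hφ.continuous).const_mul (1 / 2)
    have i4 := (integrable_mul_continuous hy.memLp hφ.continuous).const_mul (c / 2)
    have s1 := integral_add i1 i2
    have s2 := integral_add i3 i4
    simp only [integral_const_mul] at s1 s2
    have t1 : ∀ z, u z * wirt c φ z = 1 / 2 * (u z * fderiv ℝ φ z 1)
        + c / 2 * (u z * fderiv ℝ φ z Complex.I) := fun z => by
      rw [wirt]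
      ring
    have t2 : ∀ z, (ux z * (1 / 2) + uy z * (c / 2)) * φ z = 1 / 2 * (ux z * φ z)
        + c / 2 * (uy z * φ z) := fun z => by ring
    simp_rw [t1]
    have s2' : ∫ z, (ux z * (1 / 2) + uy z * (c / 2)) * φ z ∂discMeasure = _ :=
      (congrArg (fun f => ∫ z, f z ∂discMeasure) (funext t2)).trans s2
    rw [s2', s1, d1', d2']
    ring

lemma hasWeakDerivs_toL2 {m : ℕ} (U : HNat m) : HasWeakDerivs m (toL2 m U) :=
  hasWeakDerivs_jet U m (0, 0) (by simp)

/-- For a function `u` with `2 k` weak derivatives there is `g ∈ L²(D)`, the `k`-th power of the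
Zernike operator applied to `u`, whose moments against eigenpolynomials are those of `u` times the
`k`-th power of the eigenvalue. -/
lemma exists_zernikeOp_pow (k : ℕ) {u : ℂ → ℂ} (hu : HasWeakDerivs (2 * k) u) :
    ∃ g, MemLp g 2 discMeasure ∧ ∀ (P : MvPolynomial (Fin 2) ℂ) (l : ℂ), zernikeOp P = l • P →
      ∫ z, g z * polyFun P z ∂discMeasure = l ^ k * ∫ z, u z * polyFun P z ∂discMeasure := by
  induction k generalizing u with
  | zero => exact ⟨u, hu.memLp, fun P l _ => by simp⟩
  | succ k ih =>
    obtain ⟨v, hv, huv⟩ := exists_weak_zernikeOp (j := 2 * k) (u := u) hu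
    obtain ⟨g, hg, hvg⟩ := ih hv
    refine ⟨g, hg, fun P l hP => ?_⟩
    rw [hvg P l hP, huv P, hP, pow_succ, mul_assoc, ← integral_const_mul l]
    congr 2
    ext z
    rw [polyFun_smul]
    ring

/-! ### Zernike polynomials as eigenpolynomials -/

open MvPolynomial in
/-- The monomial `z^a conj(z)^b`. -/
def zmono (a b : ℕ) : MvPolynomial (Fin 2) ℂ := X 0 ^ a * X 1 ^ b

open MvPolynomial in
lemma pderiv_zero_zmono (a b : ℕ) : pderiv 0 (zmono a b) = (a : ℂ) • zmono (a - 1) b := by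
  have h : pderiv (0 : Fin 2) (X 1 : MvPolynomial (Fin 2) ℂ) = 0 := pderiv_X_of_ne (by decide)
  simp [zmono, h, Algebra.smul_def]
  ring

open MvPolynomial in
lemma pderiv_one_zmono (a b : ℕ) : pderiv 1 (zmono a b) = (b : ℂ) • zmono a (b - 1) := by
  have h : pderiv (1 : Fin 2) (X 0 : MvPolynomial (Fin 2) ℂ) = 0 := pderiv_X_of_ne (by decide)
  simp [zmono, h, Algebra.smul_def]
  ring

lemma C_two : (MvPolynomial.C 2 : MvPolynomial (Fin 2) ℂ) = 2 := map_ofNat _ 2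

lemma zernikeField_zero_zmono (a b : ℕ) :
    zernikeField 0 1 (zmono a b)
      = ((a : ℂ) + b) • zmono (a + 1) b - (2 * b : ℂ) • zmono a (b - 1) := by
  rw [zernikeField_apply, pderiv_zero_zmono, pderiv_one_zmono]
  rcases a with _ | a <;> rcases b with _ | b <;>
    simp [zmono, Algebra.smul_def, C_two] <;> ring

lemma zernikeField_one_zmono (a b : ℕ) :
    zernikeField 1 0 (zmono a b)
      = ((a : ℂ) + b) • zmono a (b + 1) - (2 * a : ℂ) • zmono (a - 1) b := by
  rw [zernikeField_apply, pderiv_zero_zmono, pderiv_one_zmono]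
  rcases a with _ | a <;> rcases b with _ | b <;>
    simp [zmono, Algebra.smul_def, C_two] <;> ring

/-- The Zernike operator is triangular on monomials. -/
lemma zernikeOp_zmono (a b : ℕ) :
    zernikeOp (zmono a b) = (((a : ℂ) + b) * (a + b + 2)) • zmono a b
      - (4 * a * b : ℂ) • zmono (a - 1) (b - 1) := by
  rw [zernikeOp_apply, zernikeField_zero_zmono, zernikeField_one_zmono]
  simp only [map_sub, Derivation.map_smul, pderiv_zero_zmono, pderiv_one_zmono,
    Nat.add_sub_cancel, smul_smul]
  push_cast
  module

lemma rotOp_zmono (a b : ℕ) : rotOp (zmono a b) = ((a : ℂ) - b) • zmono a b := by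
  rw [rotOp_apply, pderiv_zero_zmono, pderiv_one_zmono]
  rcases a with _ | a <;> rcases b with _ | b <;> simp [zmono, Algebra.smul_def] <;> ring

/-- The coefficient of `t^i` in the Jacobi polynomial `P_n^{(0,m)}(2 t - 1)`. -/
def jacobiCoeff (m n i : ℕ) : ℝ := (-1) ^ (n - i) * n.choose i * (n + m + i).choose n

open Polynomial in
/-- The expansion of `P_n^{(0,m)}(2 t - 1)` in powers of `t`, by Rodrigues' formula: `t^m` times
either side is the `n`-th derivative of `t^(n+m) (t-1)^n / n!`, computed with Leibniz' rule or with
the binomial theorem. -/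
lemma jacobiP_eq_sum (m n : ℕ) (t : ℝ) :
    jacobiP 0 m n (2 * t - 1) = ∑ i ∈ Finset.range (n + 1), jacobiCoeff m n i * t ^ i := by
  set R : ℝ[X] := derivative^[n] (X ^ (n + m) * (X - C 1) ^ n) with hR
  have h1 : R = (n.factorial : ℝ[X]) * (X ^ m * ∑ j ∈ Finset.range (n + 1),
      C (((n + 0).choose (n - j) : ℝ) * ((n + m).choose j : ℝ)) * (X - C 1) ^ j * X ^ (n - j)) := by
    rw [hR, iterate_derivative_mul, ← Finset.sum_range_reflect, Finset.mul_sum, Finset.mul_sum]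
    refine Finset.sum_congr rfl fun j hj => ?_
    have hj' : j ≤ n := Nat.lt_succ_iff.1 (Finset.mem_range.1 hj)
    have e1 : n + 1 - 1 - j = n - j := by omega
    have e2 : n - (n - j) = j := by omega
    have e3 : n + m - j = m + (n - j) := by omega
    rw [e1, e2, iterate_derivative_X_pow_eq_smul, iterate_derivative_X_sub_pow, e2, e3,
      Nat.descFactorial_eq_factorial_mul_choose (n + m) j]
    have e4 : (n.factorial : ℝ[X]) = (j.factorial : ℝ[X]) * (n.descFactorial (n - j) : ℝ[X]) := by
      have := Nat.factorial_mul_descFactorial (Nat.sub_le n j)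
      rw [e2] at this
      exact_mod_cast this.symm
    rw [e4]
    simp [smul_eq_C_mul]
    ring
  have h2 : R = (n.factorial : ℝ[X]) * (X ^ m * ∑ i ∈ Finset.range (n + 1),
      C (jacobiCoeff m n i) * X ^ i) := by
    rw [hR, sub_eq_add_neg, add_pow, Finset.mul_sum, iterate_derivative_sum, Finset.mul_sum,
      Finset.mul_sum]
    refine Finset.sum_congr rfl fun i hi => ?_
    have e1 : X ^ (n + m) * (X ^ i * (-C 1) ^ (n - i) * (n.choose i : ℝ[X]))
        = C ((-1) ^ (n - i) * (n.choose i : ℝ)) * X ^ (n + m + i) := by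
      simp
      ring
    have e2 : n + m + i - n = m + i := by omega
    rw [e1, iterate_derivative_C_mul, iterate_derivative_X_pow_eq_smul, e2,
      Nat.descFactorial_eq_factorial_mul_choose, jacobiCoeff]
    simp [smul_eq_C_mul]
    ring
  have h3 := mul_left_cancel₀ (pow_ne_zero m X_ne_zero)
    (mul_left_cancel₀ (Nat.cast_ne_zero.2 n.factorial_ne_zero) (h1.symm.trans h2))
  have h4 := congrArg (eval t) h3
  simp only [eval_finsetSum, eval_mul, eval_C, eval_pow, eval_sub, eval_X] at h4
  rw [← h4, jacobiP]
  refine Finset.sum_congr rfl fun j _ => ?_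
  have e1 : (2 * t - 1 - 1) / 2 = t - 1 := by ring
  have e2 : (2 * t - 1 + 1) / 2 = t := by ring
  rw [e1, e2]

lemma sum_jacobiCoeff (m n : ℕ) : ∑ i ∈ Finset.range (n + 1), jacobiCoeff m n i = 1 := by
  have h := jacobiP_eq_sum m n 1
  simp only [one_pow, mul_one] at h
  rw [← h, jacobiP, Finset.sum_range_succ', Finset.sum_eq_zero]
  · norm_num
  · intro i _
    norm_num

lemma jacobiCoeff_self_ne_zero (m n : ℕ) : jacobiCoeff m n n ≠ 0 := by
  have : 0 < (n + m + n).choose n := Nat.choose_pos (by omega)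
  simp [jacobiCoeff, this.ne']

lemma jacobiCoeff_succ {m n i : ℕ} (hi : i < n) :
    jacobiCoeff m n (i + 1) * ((i + 1) * (m + i + 1))
      = -((n - i) * (m + n + i + 1)) * jacobiCoeff m n i := by
  have h1 : (n.choose (i + 1) : ℝ) * (i + 1) = n.choose i * (n - i) := by
    rw [← Nat.cast_sub hi.le]
    exact_mod_cast Nat.choose_succ_right_eq n i
  have h2 : ((n + m + i).choose n : ℝ) * (n + m + i + 1)
      = (n + m + (i + 1)).choose n * (m + i + 1) := by
    have := Nat.choose_mul_succ_eq (n + m + i) n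
    have e : n + m + i + 1 - n = m + i + 1 := by omega
    rw [e] at this
    exact_mod_cast this
  have h3 : (-1 : ℝ) ^ (n - i) = -(-1) ^ (n - (i + 1)) := by
    have e : n - i = n - (i + 1) + 1 := by omega
    rw [e, pow_succ]
    ring
  rw [jacobiCoeff, jacobiCoeff, h3]
  linear_combination ((-1) ^ (n - (i + 1)) * ((n + m + (i + 1)).choose n : ℝ) * (m + i + 1)) * h1
    - ((-1) ^ (n - (i + 1)) * (n.choose i : ℝ) * (n - i)) * h2

/-- The polynomial `P_n^{(0,p+q)}(2 |z|² - 1) z^p conj(z)^q`. It is a Zernike polynomial, up to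
normalization, when `p = 0` or `q = 0`. -/
def zpoly (p q n : ℕ) : MvPolynomial (Fin 2) ℂ :=
  ∑ i ∈ Finset.range (n + 1), (jacobiCoeff (p + q) n i : ℂ) • zmono (p + i) (q + i)

lemma rotOp_zpoly (p q n : ℕ) : rotOp (zpoly p q n) = ((p : ℂ) - q) • zpoly p q n := by
  rw [zpoly, map_sum, Finset.smul_sum]
  refine Finset.sum_congr rfl fun i _ => ?_
  rw [map_smul, rotOp_zmono]
  push_cast
  module

lemma zernikeOp_zpoly {p q : ℕ} (hpq : p * q = 0) (n : ℕ) :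
    zernikeOp (zpoly p q n) = (((p : ℂ) + q + 2 * n) * (p + q + 2 * n + 2)) • zpoly p q n := by
  have hpq' : (p : ℂ) * q = 0 := by exact_mod_cast hpq
  have h1 : zernikeOp (zpoly p q n) = ∑ i ∈ Finset.range (n + 1),
        ((jacobiCoeff (p + q) n i : ℂ) * ((p + q + 2 * i) * (p + q + 2 * i + 2)))
          • zmono (p + i) (q + i)
      - ∑ i ∈ Finset.range (n + 1), ((jacobiCoeff (p + q) n i : ℂ) * (4 * (p + i) * (q + i)))
          • zmono (p + i - 1) (q + i - 1) := by
    rw [zpoly, map_sum, ← Finset.sum_sub_distrib]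
    refine Finset.sum_congr rfl fun i _ => ?_
    rw [map_smul, zernikeOp_zmono]
    push_cast
    module
  have h2 : ∀ i : ℕ, zmono (p + (i + 1) - 1) (q + (i + 1) - 1) = zmono (p + i) (q + i) :=
    fun i => rfl
  rw [h1, Finset.sum_range_succ' (fun i =>
    ((jacobiCoeff (p + q) n i : ℂ) * (4 * (p + i) * (q + i))) • zmono (p + i - 1) (q + i - 1))]
  simp only [h2]
  have h3 : ((jacobiCoeff (p + q) n 0 : ℂ) * (4 * (p + (0 : ℕ)) * (q + (0 : ℕ)))) = 0 := by
    push_cast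
    linear_combination (4 * (jacobiCoeff (p + q) n 0 : ℂ)) * hpq'
  rw [h3, zero_smul, add_zero, zpoly, Finset.sum_range_succ, Finset.sum_range_succ, smul_add,
    smul_smul, add_sub_right_comm, ← Finset.sum_sub_distrib, Finset.smul_sum]
  congr 1
  · refine Finset.sum_congr rfl fun i hi => ?_
    have h4 : ((jacobiCoeff (p + q) n (i + 1) : ℂ)) * ((i + 1) * (p + q + i + 1))
        = -((n - i) * (p + q + n + i + 1)) * jacobiCoeff (p + q) n i := by
      have := jacobiCoeff_succ (m := p + q) (Finset.mem_range.1 hi)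
      exact_mod_cast congrArg (fun x : ℝ => (x : ℂ)) this
    rw [← sub_smul, smul_smul]
    congr 1
    push_cast
    linear_combination (-4) * h4 - 4 * (jacobiCoeff (p + q) n (i + 1) : ℂ) * hpq'
  · rw [mul_comm]

lemma polyFun_zmono (a b : ℕ) (z : ℂ) : polyFun (zmono a b) z = z ^ a * star z ^ b := by
  simp [zmono, polyFun]

lemma polyFun_zpoly (p q n : ℕ) (z : ℂ) :
    polyFun (zpoly p q n) z
      = (jacobiP 0 (p + q) n (2 * ‖z‖ ^ 2 - 1) : ℝ) * (z ^ p * star z ^ q) := by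
  have hz : ((‖z‖ ^ 2 : ℝ) : ℂ) = z * star z := by
    rw [← normSq_eq_mul_star, Complex.normSq_eq_norm_sq]
  rw [jacobiP_eq_sum, zpoly, polyFun_sum, Complex.ofReal_sum, Finset.sum_mul]
  refine Finset.sum_congr rfl fun i _ => ?_
  rw [polyFun_smul, polyFun_zmono, Complex.ofReal_mul, Complex.ofReal_pow, hz]
  ring

/-- Conjugation exchanges the exponents of `z` and of its conjugate. -/
lemma star_polyFun_zpoly (p q n : ℕ) (z : ℂ) :
    star (polyFun (zpoly p q n) z) = polyFun (zpoly q p n) z := by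
  rw [polyFun_zpoly, polyFun_zpoly, star_mul', star_mul', star_pow, star_pow, star_star,
    add_comm p q, mul_comm (z ^ q)]
  congr 1
  exact Complex.conj_ofReal _

/-- The unnormalized Zernike polynomial with angular index `m` and radial index `n`. -/
def zernikePoly (m : ℤ) (n : ℕ) : MvPolynomial (Fin 2) ℂ := zpoly m.toNat (-m).toNat n

lemma zernikeFun_eq (m : ℤ) (n : ℕ) (z : ℂ) :
    zernikeFun m n z
      = (Real.sqrt (1 + (m.natAbs : ℝ) + 2 * (n : ℝ)) : ℂ) * polyFun (zernikePoly m n) z := by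
  have hpol : z = ‖z‖ * Complex.exp (Complex.arg z * Complex.I) :=
    (Complex.norm_mul_exp_arg_mul_I z).symm
  have hsum : m.toNat + (-m).toNat = m.natAbs := by omega
  have key : z ^ m.toNat * star z ^ (-m).toNat
      = (‖z‖ ^ m.natAbs : ℝ) * Complex.exp (Complex.I * (m : ℂ) * (Complex.arg z : ℂ)) := by
    rcases le_total 0 m with h | h
    · lift m to ℕ using h
      have : (-(m : ℤ)).toNat = 0 := by omega
      rw [this, Int.toNat_natCast, pow_zero, mul_one, Int.natAbs_natCast]
      conv_lhs => rw [hpol]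
      rw [mul_pow, ← Complex.exp_nat_mul]
      push_cast
      congr 2
      ring
    · obtain ⟨k, rfl⟩ : ∃ k : ℕ, m = -(k : ℤ) := ⟨(-m).toNat, by omega⟩
      have h0 : (-(k : ℤ)).toNat = 0 := by omega
      rw [h0, neg_neg, Int.toNat_natCast, pow_zero, one_mul, Int.natAbs_neg, Int.natAbs_natCast]
      have hst : star z = ‖z‖ * Complex.exp (-(Complex.arg z * Complex.I)) := by
        conv_lhs => rw [hpol]
        rw [star_mul', ← starRingEnd_apply, ← starRingEnd_apply, ← Complex.exp_conj,
          Complex.conj_ofReal, map_mul, Complex.conj_I, Complex.conj_ofReal, mul_neg]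
      rw [hst, mul_pow, ← Complex.exp_nat_mul]
      push_cast
      congr 2
      ring
  rw [zernikePoly, polyFun_zpoly, key, hsum, zernikeFun]
  push_cast
  ring

/-! ### Orthonormality of the Zernike functions -/

lemma integral_discMeasure (f : ℂ → ℂ) :
    ∫ z, f z ∂discMeasure = (Real.pi : ℂ)⁻¹ * ∫ z in unitDisc, f z := by
  rw [discMeasure, integral_smul_measure, ENNReal.toReal_inv, ENNReal.toReal_ofReal Real.pi_pos.le,
    Complex.real_smul, Complex.ofReal_inv]

lemma integral_mul_star_pow (N : ℕ) :
    ∫ z, (z * star z) ^ N ∂discMeasure = 1 / ((N : ℂ) + 1) := by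
  have h1 : ∀ z : ℂ, unitDisc.indicator (fun z => (z * star z) ^ N) z
      = (fun r : ℝ => (Set.Iio (1 : ℝ)).indicator (fun r => ((r ^ (2 * N) : ℝ) : ℂ)) r) ‖z‖ := by
    intro z
    simp only
    by_cases hz : ‖z‖ < 1
    · rw [Set.indicator_of_mem (by simpa [unitDisc] using hz),
        Set.indicator_of_mem (Set.mem_Iio.2 hz), ← normSq_eq_mul_star, Complex.normSq_eq_norm_sq,
        pow_mul]
      push_cast
      rfl
    · rw [Set.indicator_of_notMem (by simpa [unitDisc] using hz),
        Set.indicator_of_notMem (by simpa using not_lt.1 hz)]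
  have h2 : ∀ r : ℝ, r ^ (2 - 1) • (Set.Iio (1 : ℝ)).indicator
      (fun r => ((r ^ (2 * N) : ℝ) : ℂ)) r
      = (Set.Iio (1 : ℝ)).indicator (fun r => ((r ^ (2 * N + 1) : ℝ) : ℂ)) r := by
    intro r
    by_cases hr : r < 1
    · rw [Set.indicator_of_mem (by simpa using hr), Set.indicator_of_mem (by simpa using hr)]
      rw [Complex.real_smul]
      push_cast
      ring
    · rw [Set.indicator_of_notMem (by simpa using hr), Set.indicator_of_notMem (by simpa using hr),
        smul_zero]
  have hball : (volume : Measure ℂ).real (Metric.ball 0 1) = Real.pi := by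
    rw [Measure.real, Complex.volume_ball]
    simp
  have h3 : ∫ r in Set.Ioi (0 : ℝ), (Set.Iio (1 : ℝ)).indicator
      (fun r => ((r ^ (2 * N + 1) : ℝ) : ℂ)) r = ((1 / (2 * N + 2) : ℝ) : ℂ) := by
    rw [setIntegral_indicator measurableSet_Iio, Set.Ioi_inter_Iio, integral_complex_ofReal,
      ← integral_Ioc_eq_integral_Ioo, ← intervalIntegral.integral_of_le zero_le_one, integral_pow]
    push_cast
    simp
    ring
  rw [integral_discMeasure, ← integral_indicator (by unfold unitDisc; exact measurableSet_ball)]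
  simp_rw [h1]
  rw [integral_fun_norm_addHaar, Complex.finrank_real_complex, hball]
  simp_rw [h2]
  rw [h3, nsmul_eq_mul, Complex.real_smul]
  have hpi : (Real.pi : ℂ) ≠ 0 := by exact_mod_cast Real.pi_ne_zero
  have hN : (N : ℂ) + 1 ≠ 0 := by exact_mod_cast N.succ_ne_zero
  push_cast
  have hN2 : 2 * (N : ℂ) + 2 ≠ 0 := by
    rw [show 2 * (N : ℂ) + 2 = 2 * (N + 1) by ring]
    exact mul_ne_zero two_ne_zero hN
  field_simp

lemma integrable_polyFun (P : MvPolynomial (Fin 2) ℂ) : Integrable (polyFun P) discMeasure :=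
  (memLp_of_continuous (continuous_polyFun P)).integrable (by norm_num)

/-- The bilinear form `(1/π) ∫_D P Q` on polynomials. -/
def polyPairing (P Q : MvPolynomial (Fin 2) ℂ) : ℂ :=
  ∫ z, polyFun P z * polyFun Q z ∂discMeasure

lemma integrable_polyFun_mul (P Q : MvPolynomial (Fin 2) ℂ) :
    Integrable (fun z => polyFun P z * polyFun Q z) discMeasure := by
  exact (integrable_polyFun (P * Q)).congr (Eventually.of_forall (polyFun_mul P Q))

lemma polyPairing_comm (P Q : MvPolynomial (Fin 2) ℂ) : polyPairing P Q = polyPairing Q P := by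
  simp only [polyPairing, mul_comm]

lemma polyPairing_smul_right (a : ℂ) (P Q : MvPolynomial (Fin 2) ℂ) :
    polyPairing P (a • Q) = a * polyPairing P Q := by
  rw [polyPairing, polyPairing, ← integral_const_mul]
  congr 1
  ext z
  rw [polyFun_smul]
  ring

lemma polyPairing_smul_left (a : ℂ) (P Q : MvPolynomial (Fin 2) ℂ) :
    polyPairing (a • P) Q = a * polyPairing P Q := by
  rw [polyPairing_comm, polyPairing_smul_right, polyPairing_comm]

lemma polyPairing_sum_right {ι : Type*} (s : Finset ι) (P : MvPolynomial (Fin 2) ℂ)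
    (Q : ι → MvPolynomial (Fin 2) ℂ) :
    polyPairing P (∑ i ∈ s, Q i) = ∑ i ∈ s, polyPairing P (Q i) := by
  simp only [polyPairing, polyFun_sum, Finset.mul_sum]
  exact integral_finsetSum _ fun i _ => integrable_polyFun_mul P (Q i)

lemma polyPairing_sum_left {ι : Type*} (s : Finset ι) (P : MvPolynomial (Fin 2) ℂ)
    (Q : ι → MvPolynomial (Fin 2) ℂ) :
    polyPairing (∑ i ∈ s, Q i) P = ∑ i ∈ s, polyPairing (Q i) P := by
  simp only [polyPairing_comm _ P, polyPairing_sum_right]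

lemma polyPairing_add_right (P Q R : MvPolynomial (Fin 2) ℂ) :
    polyPairing P (Q + R) = polyPairing P Q + polyPairing P R := by
  simp only [polyPairing, polyFun_add, mul_add]
  exact integral_add (integrable_polyFun_mul P Q) (integrable_polyFun_mul P R)

lemma polyPairing_zmono (p q i j : ℕ) :
    polyPairing (zmono (q + i) (p + i)) (zmono (p + j) (q + j))
      = 1 / ((p : ℂ) + q + i + j + 1) := by
  have h := integral_mul_star_pow (p + q + i + j)
  push_cast at h
  rw [← h, polyPairing]
  congr 1
  ext z
  rw [polyFun_zmono, polyFun_zmono, mul_pow]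
  ring

/-- Zernike polynomials with different radial indices are orthogonal, as eigenvectors of a
symmetric operator. -/
lemma polyPairing_zpoly_of_ne {p q n n' : ℕ} (hpq : p * q = 0) (hn : n ≠ n') :
    polyPairing (zpoly q p n) (zpoly p q n') = 0 := by
  have h := integral_polyFun_mul_zernikeOp (zpoly q p n) (zpoly p q n')
  change polyPairing _ _ = polyPairing _ _ at h
  rw [zernikeOp_zpoly hpq, zernikeOp_zpoly (mul_comm p q ▸ hpq), polyPairing_smul_left,
    polyPairing_smul_right, ← sub_eq_zero, ← sub_mul] at h
  refine (mul_eq_zero.1 h).resolve_left fun h0 => ?_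
  have h1 : ((n' : ℂ) - n) * ((p + q + n + n' + 1 : ℕ) : ℂ) = 0 := by
    push_cast
    linear_combination (1 / 4) * h0
  rcases mul_eq_zero.1 h1 with h2 | h2
  · exact hn (by exact_mod_cast (sub_eq_zero.1 h2).symm)
  · exact absurd h2 (Nat.cast_ne_zero.2 (Nat.succ_ne_zero _))

/-- Polynomials with different angular frequencies are orthogonal. -/
lemma polyPairing_zpoly_of_angular_ne {p q p' q' n n' : ℕ}
    (h : (p' : ℤ) - q' ≠ p - q) : polyPairing (zpoly q p n) (zpoly p' q' n') = 0 := by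
  have h1 := integral_polyFun_mul_rotOp (zpoly q p n) (zpoly p' q' n')
  change polyPairing _ _ = -polyPairing _ _ at h1
  rw [rotOp_zpoly, rotOp_zpoly, polyPairing_smul_left, polyPairing_smul_right] at h1
  have h2 : (((p' : ℂ) - q') - (p - q)) * polyPairing (zpoly q p n) (zpoly p' q' n') = 0 := by
    linear_combination h1
  refine (mul_eq_zero.1 h2).resolve_left fun h0 => h ?_
  exact_mod_cast sub_eq_zero.1 h0

open Submodule in
/-- Monomials are combinations of Zernike polynomials, of degree not larger. -/
lemma zmono_mem_span_zpoly (p q n : ℕ) :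
    zmono (p + n) (q + n) ∈ span ℂ (zpoly p q '' Set.Iic n) := by
  induction n using Nat.strong_induction_on with
  | _ n ih =>
    have hc : (jacobiCoeff (p + q) n n : ℂ) ≠ 0 := by
      exact_mod_cast jacobiCoeff_self_ne_zero (p + q) n
    have h : zmono (p + n) (q + n) = (jacobiCoeff (p + q) n n : ℂ)⁻¹ • (zpoly p q n
        - ∑ i ∈ Finset.range n, (jacobiCoeff (p + q) n i : ℂ) • zmono (p + i) (q + i)) := by
      rw [zpoly, Finset.sum_range_succ, add_sub_cancel_left, smul_smul, inv_mul_cancel₀ hc,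
        one_smul]
    rw [h]
    refine smul_mem _ _ (sub_mem (subset_span ⟨n, Set.mem_Iic.2 le_rfl, rfl⟩)
      (sum_mem fun i hi => smul_mem _ _ ?_))
    have hi' := Finset.mem_range.1 hi
    exact span_mono (Set.image_mono (Set.Iic_subset_Iic.2 hi'.le)) (ih i hi')

lemma polyPairing_zpoly_zmono {p q n j : ℕ} (hpq : p * q = 0) (hj : j < n) :
    polyPairing (zpoly q p n) (zmono (p + j) (q + j)) = 0 := by
  have h := zmono_mem_span_zpoly p q j
  generalize zmono (p + j) (q + j) = P at h
  induction h using Submodule.span_induction with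
  | mem x hx =>
    obtain ⟨i, hi, rfl⟩ := hx
    exact polyPairing_zpoly_of_ne hpq (lt_of_le_of_lt (Set.mem_Iic.1 hi) hj).ne'
  | zero => simpa using polyPairing_smul_right 0 (zpoly q p n) 0
  | add x y _ _ hx hy => rw [polyPairing_add_right, hx, hy, add_zero]
  | smul a x _ hx => rw [polyPairing_smul_right, hx, mul_zero]

/-- The norm of a combination `∑ c_i x_i` with `∑ c_i = 1`, orthogonal to `x_j` for `j < n`, when
the Gram matrix of the `x_i` is the Cauchy matrix `1 / (M + i + j + 1)`. Multiplying the entries of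
the Gram matrix by `M + i + j + 1` yields `(∑ c_i)² = 1`, while `i` and `j` may be replaced by `n`
because of orthogonality. -/
lemma cauchy_form_mul_eq_one {n : ℕ} {M : ℂ} {c : ℕ → ℂ} {g : ℕ → ℕ → ℂ}
    (hg : ∀ i j, g i j * (M + i + j + 1) = 1) (hsymm : ∀ i j, g i j = g j i)
    (hc : ∑ i ∈ Finset.range (n + 1), c i = 1)
    (horth : ∀ j < n, ∑ i ∈ Finset.range (n + 1), c i * g i j = 0) :
    (∑ j ∈ Finset.range (n + 1), c j * ∑ i ∈ Finset.range (n + 1), c i * g i j)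
      * (M + 2 * n + 1) = 1 := by
  set G : ℕ → ℂ := fun j => ∑ i ∈ Finset.range (n + 1), c i * g i j with hG
  set J : ℂ := ∑ j ∈ Finset.range (n + 1), c j * G j with hJ
  have hlast : ∀ f : ℕ → ℂ, ∑ j ∈ Finset.range (n + 1), f j * (c j * G j) = f n * (c n * G n) := by
    intro f
    rw [Finset.sum_range_succ, Finset.sum_eq_zero, zero_add]
    intro j hj
    have : G j = 0 := horth j (Finset.mem_range.1 hj)
    rw [this, mul_zero, mul_zero]
  have hJn : J = c n * G n := by
    have := hlast fun _ => 1
    simpa using this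
  have h1 : ∑ j ∈ Finset.range (n + 1), (j : ℂ) * (c j * G j) = n * J := by
    rw [hlast fun j => (j : ℂ), hJn]
  have h2 : ∑ j ∈ Finset.range (n + 1), ∑ i ∈ Finset.range (n + 1), (i : ℂ) * (c j * c i * g i j)
      = n * J := by
    rw [Finset.sum_comm, ← h1]
    refine Finset.sum_congr rfl fun i _ => ?_
    rw [hG, Finset.mul_sum, Finset.mul_sum]
    refine Finset.sum_congr rfl fun j _ => ?_
    rw [hsymm i j]
    ring
  have h3 : ∑ j ∈ Finset.range (n + 1), ∑ i ∈ Finset.range (n + 1), c j * c i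
      = (M + 1) * J + ∑ j ∈ Finset.range (n + 1), (j : ℂ) * (c j * G j)
        + ∑ j ∈ Finset.range (n + 1), ∑ i ∈ Finset.range (n + 1),
          (i : ℂ) * (c j * c i * g i j) := by
    rw [hJ, Finset.mul_sum, ← Finset.sum_add_distrib, ← Finset.sum_add_distrib]
    refine Finset.sum_congr rfl fun j _ => ?_
    rw [hG, Finset.mul_sum, Finset.mul_sum, Finset.mul_sum, ← Finset.sum_add_distrib,
      ← Finset.sum_add_distrib]
    refine Finset.sum_congr rfl fun i _ => ?_
    linear_combination (-(c j * c i)) * hg i j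
  rw [← Finset.sum_mul_sum, hc, h1, h2] at h3
  linear_combination -h3

lemma polyPairing_zpoly_self {p q : ℕ} (hpq : p * q = 0) (n : ℕ) :
    polyPairing (zpoly q p n) (zpoly p q n) * ((p : ℂ) + q + 2 * n + 1) = 1 := by
  have hG : ∀ j, polyPairing (zpoly q p n) (zmono (p + j) (q + j))
      = ∑ i ∈ Finset.range (n + 1), (jacobiCoeff (p + q) n i : ℂ)
        * (1 / ((p : ℂ) + q + i + j + 1)) := by
    intro j
    rw [zpoly, polyPairing_sum_left]
    refine Finset.sum_congr rfl fun i _ => ?_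
    rw [polyPairing_smul_left, polyPairing_zmono, add_comm q p]
  have h : polyPairing (zpoly q p n) (zpoly p q n)
      = ∑ j ∈ Finset.range (n + 1), (jacobiCoeff (p + q) n j : ℂ)
        * ∑ i ∈ Finset.range (n + 1), (jacobiCoeff (p + q) n i : ℂ)
          * (1 / ((p : ℂ) + q + i + j + 1)) := by
    conv_lhs => rw [zpoly.eq_def p q n, polyPairing_sum_right]
    refine Finset.sum_congr rfl fun j _ => ?_
    rw [polyPairing_smul_right, hG]
  rw [h]
  refine cauchy_form_mul_eq_one (M := (p : ℂ) + q) (fun i j => ?_) (fun i j => ?_) ?_ fun j hj => ?_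
  · have : (p : ℂ) + q + i + j + 1 ≠ 0 := by exact_mod_cast Nat.succ_ne_zero (p + q + i + j)
    field_simp
  · ring
  · exact_mod_cast congrArg (fun x : ℝ => (x : ℂ)) (sum_jacobiCoeff (p + q) n)
  · rw [← hG, polyPairing_zpoly_zmono hpq hj]

lemma toNat_mul_toNat_neg (m : ℤ) : m.toNat * (-m).toNat = 0 := by
  rcases le_total 0 m with h | h
  · rw [show (-m).toNat = 0 by omega, mul_zero]
  · rw [show m.toNat = 0 by omega, zero_mul]

lemma star_polyFun_zernikePoly (m : ℤ) (n : ℕ) (z : ℂ) :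
    star (polyFun (zernikePoly m n) z) = polyFun (zernikePoly (-m) n) z := by
  rw [zernikePoly, star_polyFun_zpoly, zernikePoly, neg_neg]

lemma star_zernikeFun (m : ℤ) (n : ℕ) (z : ℂ) :
    star (zernikeFun m n z) = (Real.sqrt (1 + (m.natAbs : ℝ) + 2 * (n : ℝ)) : ℂ)
      * polyFun (zernikePoly (-m) n) z := by
  rw [zernikeFun_eq, star_mul', star_polyFun_zernikePoly]
  congr 1
  exact Complex.conj_ofReal _

lemma inner_zernike (m : ℤ) (n : ℕ) (v : L2Disc) :
    inner ℂ (zernike m n) v = (Real.sqrt (1 + (m.natAbs : ℝ) + 2 * (n : ℝ)) : ℂ)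
      * ∫ z, v z * polyFun (zernikePoly (-m) n) z ∂discMeasure := by
  rw [L2.inner_def, ← integral_const_mul]
  refine integral_congr_ae ?_
  filter_upwards [(memLp_zernikeFun m n).coeFn_toLp] with z hz
  rw [RCLike.inner_apply, zernike, hz]
  change _ * star _ = _
  rw [star_zernikeFun]
  ring

lemma inner_zernike_zernike (m m' : ℤ) (n n' : ℕ) :
    inner ℂ (zernike m n) (zernike m' n') = (Real.sqrt (1 + (m.natAbs : ℝ) + 2 * (n : ℝ)) : ℂ)
      * ((Real.sqrt (1 + (m'.natAbs : ℝ) + 2 * (n' : ℝ)) : ℂ)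
        * polyPairing (zernikePoly (-m) n) (zernikePoly m' n')) := by
  rw [inner_zernike, polyPairing,
    ← integral_const_mul (Real.sqrt (1 + (m'.natAbs : ℝ) + 2 * (n' : ℝ)) : ℂ)]
  refine congrArg (HMul.hMul _) (integral_congr_ae ?_)
  filter_upwards [(memLp_zernikeFun m' n').coeFn_toLp] with z hz
  rw [zernike, hz, zernikeFun_eq]
  ring

theorem orthonormal_zernike : Orthonormal ℂ fun i : ℤ × ℕ => zernike i.1 i.2 := by
  classical
  rw [orthonormal_iff_ite]
  rintro ⟨m, n⟩ ⟨m', n'⟩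
  rw [inner_zernike_zernike, zernikePoly, zernikePoly, neg_neg]
  by_cases hm : m = m'
  · subst hm
    by_cases hn : n = n'
    · subst hn
      have h := polyPairing_zpoly_self (toNat_mul_toNat_neg m) n
      have hnn : 0 ≤ 1 + (m.natAbs : ℝ) + 2 * (n : ℝ) := by positivity
      have hs : (Real.sqrt (1 + (m.natAbs : ℝ) + 2 * (n : ℝ)) : ℂ)
          * (Real.sqrt (1 + (m.natAbs : ℝ) + 2 * (n : ℝ)) : ℂ)
          = (m.toNat : ℂ) + (-m).toNat + 2 * n + 1 := by
        have hsum : m.natAbs = m.toNat + (-m).toNat := by omega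
        rw [← Complex.ofReal_mul, Real.mul_self_sqrt hnn, hsum]
        push_cast
        ring
      rw [if_pos rfl, ← mul_assoc, hs, mul_comm, h]
    · rw [if_neg (by simp [hn]), polyPairing_zpoly_of_ne (toNat_mul_toNat_neg m) hn, mul_zero,
        mul_zero]
  · rw [if_neg (by simp [hm]), polyPairing_zpoly_of_angular_ne (by omega), mul_zero, mul_zero]

/-! ### Completeness of the Zernike functions -/

lemma zernikePoly_sub {p q : ℕ} (hpq : p * q = 0) (n : ℕ) :
    zernikePoly ((p : ℤ) - q) n = zpoly p q n := by
  rcases mul_eq_zero.1 hpq with rfl | rfl <;> simp [zernikePoly]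

open MvPolynomial in
lemma mem_span_zernikePoly (P : MvPolynomial (Fin 2) ℂ) :
    P ∈ Submodule.span ℂ (Set.range fun i : ℤ × ℕ => zernikePoly i.1 i.2) := by
  have hmono : ∀ a b : ℕ,
      zmono a b ∈ Submodule.span ℂ (Set.range fun i : ℤ × ℕ => zernikePoly i.1 i.2) := by
    intro a b
    have key : ∀ p q n : ℕ, p * q = 0 → zmono (p + n) (q + n)
        ∈ Submodule.span ℂ (Set.range fun i : ℤ × ℕ => zernikePoly i.1 i.2) := by
      intro p q n hpq
      refine Submodule.span_mono ?_ (zmono_mem_span_zpoly p q n)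
      rintro _ ⟨j, _, rfl⟩
      exact ⟨((p : ℤ) - q, j), zernikePoly_sub hpq j⟩
    rcases le_total a b with h | h
    · simpa [Nat.sub_add_cancel h] using key 0 (b - a) a (zero_mul _)
    · simpa [Nat.sub_add_cancel h] using key (a - b) 0 b (mul_zero _)
  induction P using MvPolynomial.induction_on' with
  | monomial u a =>
    have : monomial u a = a • zmono (u 0) (u 1) := by
      rw [monomial_eq, Finsupp.prod_fintype _ _ (by simp), Fin.prod_univ_two, zmono,
        smul_eq_C_mul]
    rw [this]
    exact Submodule.smul_mem _ _ (hmono _ _)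
  | add P Q hP hQ => exact Submodule.add_mem _ hP hQ

/-- A polynomial in `z` and `conj z`, as an element of `L²(D)`. -/
def polyL2 : MvPolynomial (Fin 2) ℂ →ₗ[ℂ] L2Disc where
  toFun P := (memLp_of_continuous (continuous_polyFun P)).toLp (polyFun P)
  map_add' P Q := by
    rw [← MemLp.toLp_add]
    congr 1
    exact funext (polyFun_add P Q)
  map_smul' a P := by
    rw [RingHom.id_apply, ← MemLp.toLp_const_smul]
    congr 1
    exact funext (polyFun_smul a P)

lemma polyL2_zernikePoly (m : ℤ) (n : ℕ) :
    polyL2 (zernikePoly m n)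
      = (Real.sqrt (1 + (m.natAbs : ℝ) + 2 * (n : ℝ)) : ℂ)⁻¹ • zernike m n := by
  have hpos : 0 < Real.sqrt (1 + (m.natAbs : ℝ) + 2 * (n : ℝ)) := Real.sqrt_pos.2 (by positivity)
  have hne : (Real.sqrt (1 + (m.natAbs : ℝ) + 2 * (n : ℝ)) : ℂ) ≠ 0 := by exact_mod_cast hpos.ne'
  rw [eq_inv_smul_iff₀ hne, ← map_smul]
  refine MemLp.toLp_congr (memLp_of_continuous (continuous_polyFun _)) (memLp_zernikeFun m n)
    (Eventually.of_forall fun z => ?_)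
  rw [polyFun_smul, zernikeFun_eq]

lemma polyL2_mem_span (P : MvPolynomial (Fin 2) ℂ) :
    polyL2 P ∈ Submodule.span ℂ (Set.range fun i : ℤ × ℕ => zernike i.1 i.2) := by
  have h := mem_span_zernikePoly P
  induction h using Submodule.span_induction with
  | mem x hx =>
    obtain ⟨i, rfl⟩ := hx
    simp only [polyL2_zernikePoly]
    exact Submodule.smul_mem _ _ (Submodule.subset_span ⟨i, rfl⟩)
  | zero => rw [map_zero]; exact Submodule.zero_mem _
  | add x y _ _ hx hy => rw [map_add]; exact Submodule.add_mem _ hx hy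
  | smul a x _ hx => rw [map_smul]; exact Submodule.smul_mem _ _ hx

open MvPolynomial in
/-- Polynomials in `z` and `conj z` are uniformly dense on the closed disc. -/
lemma exists_polyFun_near (f : C(Metric.closedBall (0 : ℂ) 1, ℂ)) {ε : ℝ} (hε : 0 < ε) :
    ∃ P, ∀ z : Metric.closedBall (0 : ℂ) 1, ‖f z - polyFun P z‖ < ε := by
  let A : Subalgebra ℂ C(Metric.closedBall (0 : ℂ) 1, ℂ) :=
    { carrier := {g | ∃ P, ∀ z, g z = polyFun P z}
      mul_mem' := by
        rintro g h ⟨P, hP⟩ ⟨Q, hQ⟩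
        exact ⟨P * Q, fun z => by rw [polyFun_mul, ← hP, ← hQ, ContinuousMap.mul_apply]⟩
      add_mem' := by
        rintro g h ⟨P, hP⟩ ⟨Q, hQ⟩
        exact ⟨P + Q, fun z => by rw [polyFun_add, ← hP, ← hQ, ContinuousMap.add_apply]⟩
      algebraMap_mem' := fun a => ⟨C a, fun z => by rw [polyFun_C]; rfl⟩ }
  have hf : f ∈ A.topologicalClosure := by
    induction f using ContinuousMap.induction_on_of_compact with
    | const a => exact A.le_topologicalClosure ⟨C a, fun z => by rw [polyFun_C]; rfl⟩
    | id => exact A.le_topologicalClosure ⟨X 0, fun z => by rw [polyFun_X_zero]; rfl⟩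
    | star_id => exact A.le_topologicalClosure ⟨X 1, fun z => by rw [polyFun_X_one]; rfl⟩
    | add f g hf hg => exact add_mem hf hg
    | mul f g hf hg => exact mul_mem hf hg
    | frequently f hf =>
      exact A.isClosed_topologicalClosure.closure_subset (mem_closure_iff_frequently.2 hf)
  rw [← SetLike.mem_coe, Subalgebra.topologicalClosure_coe] at hf
  obtain ⟨g, ⟨P, hP⟩, hg⟩ := Metric.mem_closure_iff.1 hf ε hε
  refine ⟨P, fun z => ?_⟩
  rw [← hP, ← dist_eq_norm]
  exact (ContinuousMap.dist_apply_le_dist z).trans_lt hg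

theorem span_zernike_dense :
    ⊤ ≤ (Submodule.span ℂ (Set.range fun i : ℤ × ℕ => zernike i.1 i.2)).topologicalClosure := by
  set W := (Submodule.span ℂ (Set.range fun i : ℤ × ℕ => zernike i.1 i.2)).topologicalClosure
  have hW : IsClosed (W : Set L2Disc) := Submodule.isClosed_topologicalClosure _
  have hbcf : ∀ f : BoundedContinuousFunction ℂ ℂ,
      BoundedContinuousFunction.toLp 2 discMeasure ℂ f ∈ W := by
    intro f
    rw [← SetLike.mem_coe, ← hW.closure_eq, Metric.mem_closure_iff]
    intro ε hε
    set K : ℝ := (measureUnivNNReal discMeasure : ℝ) ^ (ENNReal.toReal 2)⁻¹ with hK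
    have hK0 : 0 ≤ K := by positivity
    obtain ⟨P, hP⟩ := exists_polyFun_near
      (f.toContinuousMap.restrict (Metric.closedBall (0 : ℂ) 1)) (ε := ε / (K + 1)) (by positivity)
    refine ⟨polyL2 P, Submodule.le_topologicalClosure _ (polyL2_mem_span P), ?_⟩
    rw [dist_eq_norm]
    have hb : ∀ᵐ z ∂discMeasure,
        ‖(BoundedContinuousFunction.toLp 2 discMeasure ℂ f - polyL2 P : L2Disc) z‖
          ≤ ε / (K + 1) := by
      filter_upwards [ae_mem_unitDisc, Lp.coeFn_sub
        (BoundedContinuousFunction.toLp 2 discMeasure ℂ f) (polyL2 P),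
        BoundedContinuousFunction.coeFn_toLp (p := 2) (𝕜 := ℂ) discMeasure f,
        (memLp_of_continuous (continuous_polyFun P)).coeFn_toLp] with z hz h1 h2 h3
      have h3' : (polyL2 P : L2Disc) z = polyFun P z := h3
      rw [h1, Pi.sub_apply, h2, h3']
      exact (hP ⟨z, Metric.ball_subset_closedBall hz⟩).le
    refine (Lp.norm_le_of_ae_bound (by positivity) hb).trans_lt ?_
    change K * (ε / (K + 1)) < ε
    rw [mul_div_assoc', div_lt_iff₀ (by positivity)]
    nlinarith
  intro v _
  have hd := BoundedContinuousFunction.toLp_denseRange ℂ discMeasure ℂ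
    (p := 2) (by norm_num) v
  exact closure_minimal (by rintro _ ⟨f, rfl⟩; exact hbcf f) hW hd

/-- The Zernike functions as a Hilbert basis of `L²(D)`. -/
def zernikeBasis : HilbertBasis (ℤ × ℕ) ℂ L2Disc :=
  HilbertBasis.mk orthonormal_zernike span_zernike_dense

lemma zernikeBasis_apply (i : ℤ × ℕ) : zernikeBasis i = zernike i.1 i.2 := by
  rw [zernikeBasis, HilbertBasis.coe_mk]

/-! ### The projection error for Sobolev spaces of even order -/

/-- The projection `P_{MN}` as a bounded operator. -/
def zernikeProjL (M N : ℕ) : L2Disc →L[ℂ] L2Disc :=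
  ∑ i ∈ Finset.Icc (-(M : ℤ)) (M : ℤ) ×ˢ Finset.range (N + 1),
    (innerSL ℂ (zernike i.1 i.2)).smulRight (zernike i.1 i.2)

lemma zernikeProjL_apply (M N : ℕ) (v : L2Disc) : zernikeProjL M N v
    = ∑ i ∈ Finset.Icc (-(M : ℤ)) (M : ℤ) ×ˢ Finset.range (N + 1),
      inner ℂ (zernike i.1 i.2) v • zernike i.1 i.2 := by
  simp [zernikeProjL]

lemma zernikeProj_eq (M N : ℕ) (v : L2Disc) : zernikeProj M N v = zernikeProjL M N v := by
  rw [zernikeProjL_apply, zernikeProj, Finset.sum_product]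

lemma hasSum_sq_norm_inner_zernike (v : L2Disc) :
    HasSum (fun i : ℤ × ℕ => ‖inner ℂ (zernike i.1 i.2) v‖ ^ 2) (‖v‖ ^ 2) := by
  have h := (zernikeBasis.hasSum_inner_mul_inner v v).mapL Complex.reCLM
  convert h using 1
  · ext i
    rw [zernikeBasis_apply, ← inner_conj_symm, Complex.mul_conj', RCLike.norm_conj]
    simp [← Complex.ofReal_pow]
  · exact (inner_self_eq_norm_sq (𝕜 := ℂ) v).symm

/-- The eigenvalue `d (d + 2)`, `d = |m| + 2 n`, of the Zernike operator at `ζ_{mn}`. -/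
def zernikeEigenvalue (i : ℤ × ℕ) : ℝ :=
  ((i.1.natAbs : ℝ) + 2 * i.2) * (i.1.natAbs + 2 * i.2 + 2)

lemma zernikeOp_zernikePoly (m : ℤ) (n : ℕ) :
    zernikeOp (zernikePoly (-m) n) = (zernikeEigenvalue (m, n) : ℂ) • zernikePoly (-m) n := by
  rw [zernikePoly, zernikeOp_zpoly (toNat_mul_toNat_neg (-m))]
  congr 1
  have hsum : m.natAbs = (-m).toNat + (- -m).toNat := by omega
  rw [zernikeEigenvalue, hsum]
  push_cast
  ring

/-- Outside of the index range of `P_{MN}` the eigenvalues exceed `min(M, 2N)²`. -/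
lemma sq_min_le_zernikeEigenvalue {M N : ℕ} {i : ℤ × ℕ}
    (hi : i ∉ Finset.Icc (-(M : ℤ)) (M : ℤ) ×ˢ Finset.range (N + 1)) :
    (min (M : ℝ) (2 * N)) ^ 2 ≤ zernikeEigenvalue i := by
  have h : min M (2 * N) ≤ i.1.natAbs + 2 * i.2 := by
    simp only [Finset.mem_product, Finset.mem_Icc, Finset.mem_range] at hi
    omega
  have h' : min (M : ℝ) (2 * N) ≤ i.1.natAbs + 2 * i.2 := by exact_mod_cast h
  have h0 : 0 ≤ min (M : ℝ) (2 * N) := by positivity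
  rw [zernikeEigenvalue]
  nlinarith

lemma norm_sub_zernikeProj_le_of_inner {v g : L2Disc} {k : ℕ}
    (h : ∀ i : ℤ × ℕ, inner ℂ (zernike i.1 i.2) g
      = (zernikeEigenvalue i : ℂ) ^ k * inner ℂ (zernike i.1 i.2) v) (M N : ℕ) :
    (min (M : ℝ) (2 * N)) ^ (2 * k) * ‖v - zernikeProjL M N v‖ ≤ ‖g‖ := by
  set a : ℝ := min (M : ℝ) (2 * N) with ha
  have ha0 : 0 ≤ a := by positivity
  refine le_of_sq_le_sq ?_ (norm_nonneg _)
  rw [mul_pow]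
  refine hasSum_le (fun i => ?_)
    ((hasSum_sq_norm_inner_zernike (v - zernikeProjL M N v)).mul_left ((a ^ (2 * k)) ^ 2))
    (hasSum_sq_norm_inner_zernike g)
  rw [inner_sub_right, zernikeProjL_apply]
  by_cases hi : i ∈ Finset.Icc (-(M : ℤ)) (M : ℤ) ×ˢ Finset.range (N + 1)
  · rw [orthonormal_zernike.inner_right_sum (fun i : ℤ × ℕ => inner ℂ (zernike i.1 i.2) v) hi,
      sub_self, norm_zero]
    simp
  · have h0 : inner ℂ (zernike i.1 i.2)
        (∑ i ∈ Finset.Icc (-(M : ℤ)) (M : ℤ) ×ˢ Finset.range (N + 1),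
          inner ℂ (zernike i.1 i.2) v • zernike i.1 i.2) = 0 := by
      rw [inner_sum]
      refine Finset.sum_eq_zero fun j hj => ?_
      have hij : i ≠ j := fun e => hi (e ▸ hj)
      rw [inner_smul_right, orthonormal_zernike.2 hij, mul_zero]
    have hev := sq_min_le_zernikeEigenvalue hi
    have hev0 : 0 ≤ zernikeEigenvalue i := (sq_nonneg _).trans hev
    rw [h0, sub_zero, h i, norm_mul, mul_pow, norm_pow, Complex.norm_real,
      Real.norm_of_nonneg hev0, pow_mul]
    gcongr

/-- The projection error on `H^{2k}(D)`. The bound is uniform in the function by the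
Banach-Steinhaus theorem, since `min(M,2N)^{2k} ‖v - P_{MN} v‖` is bounded by the norm of the `k`-th
power of the Zernike operator applied to `v`. -/
theorem exists_norm_sub_zernikeProj_le (k : ℕ) :
    ∃ C : ℝ, 0 < C ∧ ∀ (U : HNat (2 * k)) (M N : ℕ),
      (min (M : ℝ) (2 * N)) ^ (2 * k) * ‖toL2 (2 * k) U - zernikeProjL M N (toL2 (2 * k) U)‖
        ≤ C * ‖U‖ := by
  let A : ℕ × ℕ → HNat (2 * k) →L[ℂ] L2Disc := fun p =>
    (((min (p.1 : ℝ) (2 * p.2)) ^ (2 * k) : ℝ) : ℂ) •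
      (toL2 (2 * k) - (zernikeProjL p.1 p.2).comp (toL2 (2 * k)))
  have hA : ∀ (p : ℕ × ℕ) (U : HNat (2 * k)), ‖A p U‖ = (min (p.1 : ℝ) (2 * p.2)) ^ (2 * k)
      * ‖toL2 (2 * k) U - zernikeProjL p.1 p.2 (toL2 (2 * k) U)‖ := by
    intro p U
    have h0 : 0 ≤ (min (p.1 : ℝ) (2 * p.2)) ^ (2 * k) := by positivity
    simp only [A, smul_apply, sub_apply, ContinuousLinearMap.comp_apply,
      norm_smul, Complex.norm_real, Real.norm_of_nonneg h0]
  obtain ⟨C, hC⟩ := banach_steinhaus (g := A) fun U => by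
    -- the pointwise bound is the norm of the `k`-th power of the Zernike operator applied to `U`
    obtain ⟨g, hg, hgP⟩ := exists_zernikeOp_pow k (hasWeakDerivs_toL2 U)
    refine ⟨‖hg.toLp g‖, fun p => ?_⟩
    rw [hA]
    refine norm_sub_zernikeProj_le_of_inner (fun i => ?_) p.1 p.2
    have e : ∫ z, (hg.toLp g) z * polyFun (zernikePoly (-i.1) i.2) z ∂discMeasure
        = ∫ z, g z * polyFun (zernikePoly (-i.1) i.2) z ∂discMeasure := by
      refine integral_congr_ae ?_
      filter_upwards [hg.coeFn_toLp] with z hz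
      rw [hz]
    rw [inner_zernike, inner_zernike, e, hgP _ _ (zernikeOp_zernikePoly i.1 i.2)]
    ring
  refine ⟨max C 1, by positivity, fun U M N => ?_⟩
  rw [← hA (M, N) U]
  exact ((A (M, N)).le_of_opNorm_le (hC _) U).trans
    (mul_le_mul_of_nonneg_right (le_max_left _ _) (norm_nonneg _))

/-! ### Interpolation -/

section

variable {H F : Type*} [NormedAddCommGroup H] [InnerProductSpace ℂ H] [CompleteSpace H]
  [NormedAddCommGroup F] [InnerProductSpace ℂ F] [CompleteSpace F]

lemma norm_sq_posRpow_posSqrt {Q : H →L[ℂ] H} {r : ℝ} (hr : 0 < r) (x : H) :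
    ‖posRpow (posSqrt Q) r x‖ ^ 2 = RCLike.re (inner ℂ ((Q ^ r) x) x) := by
  lift r to NNReal using hr.le
  have hr' : 0 < r := by exact_mod_cast hr
  have e1 : posRpow (posSqrt Q) (r : ℝ) = posSqrt Q ^ r := (CFC.nnrpow_eq_rpow hr').symm
  have e2 : posSqrt Q ^ r * posSqrt Q ^ r = Q ^ (r : ℝ) := by
    rw [← CFC.nnrpow_add hr' hr', posSqrt, CFC.nnrpow_sqrt, add_self_div_two,
      CFC.nnrpow_eq_rpow hr']
  have hS : 0 ≤ posSqrt Q ^ r := CFC.nnrpow_nonneg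
  have hsym := ((ContinuousLinearMap.nonneg_iff_isPositive _).1 hS).isSymmetric
  have h := hsym ((posSqrt Q ^ r) x) x
  rw [e1, ← e2, norm_sq_eq_re_inner (𝕜 := ℂ)]
  exact congrArg RCLike.re h.symm

lemma rpow_mul_bound {x c ν : ℝ} (hx : 0 ≤ x) (hxc : x ≤ c) (h0 : 0 < ν) (h1 : ν < 1) :
    x ≤ c ^ ν * x ^ (1 - ν) := by
  calc x = x ^ ν * x ^ (1 - ν) := by
        rw [← Real.rpow_add_of_nonneg hx h0.le (by linarith), add_sub_cancel, Real.rpow_one]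
    _ ≤ c ^ ν * x ^ (1 - ν) := by gcongr

/-- For a positive operator `R` of norm at most `c`, one has `R ≤ c^ν R^{1-ν}`. -/
lemma le_smul_rpow {R : H →L[ℂ] H} (hR : 0 ≤ R) {c ν : ℝ} (hc : ‖R‖ ≤ c) (h0 : 0 < ν)
    (h1 : ν < 1) : R ≤ (c ^ ν) • R ^ (1 - ν) := by
  have hsa : IsSelfAdjoint R := IsSelfAdjoint.of_nonneg hR
  have hν : 0 < 1 - ν := by linarith
  have hcont : ContinuousOn (fun x : ℝ => x ^ (1 - ν)) (spectrum ℝ R) :=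
    (Real.continuous_rpow_const hν.le).continuousOn
  rw [CFC.rpow_eq_cfc_real hR, ← cfc_smul (c ^ ν) (fun x : ℝ => x ^ (1 - ν)) R hcont]
  conv_lhs => rw [← cfc_id' ℝ R]
  refine (cfc_le_iff (fun x : ℝ => x) (fun x => c ^ ν • x ^ (1 - ν)) R).2 fun x hx => ?_
  have hx0 : 0 ≤ x := spectrum_nonneg_of_nonneg hR hx
  refine rpow_mul_bound hx0 ?_ h0 h1
  have hn := spectrum.norm_le_norm_mul_of_mem hx
  rw [Real.norm_of_nonneg hx0] at hn
  exact (hn.trans (mul_le_of_le_one_right (norm_nonneg _) ContinuousLinearMap.norm_id_le)).trans hc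

/-- Interpolation: bounds for `T` in terms of `√⟨Q x, x⟩` and of `‖x‖` yield one in terms of
`‖Q^{(1-ν)/2} x‖`. With `R = T* T` normalized so that `R ≤ Q`, the Löwner-Heinz inequality gives
`R ≤ ‖R‖^ν R^{1-ν} ≤ ‖R‖^ν Q^{1-ν}`. -/
theorem norm_le_norm_posRpow {T : H →L[ℂ] F} {Q : H →L[ℂ] H} {α β ν : ℝ} (hQ : 0 ≤ Q)
    (hα : 0 < α) (hβ : 0 ≤ β) (h0 : 0 < ν) (h1 : ν < 1)
    (hTQ : ∀ x, ‖T x‖ ^ 2 ≤ α ^ 2 * RCLike.re (inner ℂ (Q x) x))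
    (hT : ∀ x, ‖T x‖ ≤ β * ‖x‖) (x : H) :
    ‖T x‖ ≤ α ^ (1 - ν) * β ^ ν * ‖posRpow (posSqrt Q) (1 - ν) x‖ := by
  have hν : 0 < 1 - ν := by linarith
  set T' : H →L[ℂ] F := ((α⁻¹ : ℝ) : ℂ) • T with hT'
  have hT'n : ∀ x, ‖T' x‖ = α⁻¹ * ‖T x‖ := fun x => by
    rw [hT', smul_apply, norm_smul, Complex.norm_real,
      Real.norm_of_nonneg (inv_nonneg.2 hα.le)]
  set R : H →L[ℂ] H := ContinuousLinearMap.adjoint T' ∘L T' with hR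
  have hR0 : 0 ≤ R := (ContinuousLinearMap.nonneg_iff_isPositive _).2
    (ContinuousLinearMap.isPositive_adjoint_comp_self _)
  have hRx : ∀ x, RCLike.re (inner ℂ (R x) x) = ‖T' x‖ ^ 2 := fun x => by
    rw [hR, ContinuousLinearMap.comp_apply, ContinuousLinearMap.adjoint_inner_left,
      norm_sq_eq_re_inner (𝕜 := ℂ)]
  have hle : ∀ A B : H →L[ℂ] H, A ≤ B → ∀ x,
      RCLike.re (inner ℂ (A x) x) ≤ RCLike.re (inner ℂ (B x) x) := by
    intro A B hAB x
    have := ((ContinuousLinearMap.le_def A B).1 hAB).re_inner_nonneg_left x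
    rw [sub_apply, inner_sub_left, map_sub] at this
    linarith
  have hRQ : R ≤ Q := by
    rw [ContinuousLinearMap.le_def, ContinuousLinearMap.isPositive_def']
    refine ⟨(IsSelfAdjoint.of_nonneg hQ).sub (IsSelfAdjoint.of_nonneg hR0), fun x => ?_⟩
    rw [ContinuousLinearMap.reApplyInnerSelf_apply, sub_apply, inner_sub_left,
      map_sub, hRx, hT'n, sub_nonneg, mul_pow, inv_pow]
    rw [inv_mul_le_iff₀ (by positivity)]
    exact hTQ x
  have hb : ‖R‖ ≤ (α⁻¹ * β) ^ 2 := by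
    have hTb : ‖T'‖ ≤ α⁻¹ * β := by
      refine ContinuousLinearMap.opNorm_le_bound _ (by positivity) fun x => ?_
      rw [hT'n, mul_assoc]
      exact mul_le_mul_of_nonneg_left (hT x) (by positivity)
    calc ‖R‖ ≤ ‖ContinuousLinearMap.adjoint T'‖ * ‖T'‖ := ContinuousLinearMap.opNorm_comp_le _ _
      _ = ‖T'‖ ^ 2 := by rw [LinearIsometryEquiv.norm_map, sq]
      _ ≤ (α⁻¹ * β) ^ 2 := by gcongr
  have hLH : R ^ (1 - ν) ≤ Q ^ (1 - ν) :=
    CFC.rpow_le_rpow ⟨hν.le, by linarith⟩ hRQ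
  have key : ‖T' x‖ ^ 2 ≤ ((α⁻¹ * β) ^ ν * ‖posRpow (posSqrt Q) (1 - ν) x‖) ^ 2 := by
    rw [← hRx, mul_pow, norm_sq_posRpow_posSqrt hν]
    refine (hle _ _ (le_smul_rpow hR0 hb h0 h1) x).trans ?_
    have e : ((α⁻¹ * β) ^ 2) ^ ν = ((α⁻¹ * β) ^ ν) ^ 2 := by
      rw [← Real.rpow_natCast, ← Real.rpow_natCast, ← Real.rpow_mul (by positivity),
        ← Real.rpow_mul (by positivity), mul_comm ν]
    rw [smul_apply, inner_smul_left_eq_smul, RCLike.smul_re, e]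
    exact mul_le_mul_of_nonneg_left (hle _ _ hLH x) (by positivity)
  have key' := le_of_sq_le_sq key (by positivity)
  rw [hT'n, inv_mul_le_iff₀ hα, Real.mul_rpow (by positivity) hβ, Real.inv_rpow hα.le] at key'
  refine key'.trans_eq ?_
  rw [Real.rpow_sub hα, Real.rpow_one]
  ring

end

/-- The error of the projection on `H^{2k+2}(D)` in terms of the norm of `H^{2(k+ν)}(D)`: this
interpolates between the bounds on `H^{2k}(D)` and `H^{2k+2}(D)`. -/
lemma exists_norm_sub_zernikeProj_le_opSpow (k : ℕ) {ν : ℝ} (h0 : 0 < ν) (h1 : ν < 1) :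
    ∃ C : ℝ, 0 < C ∧ ∀ (x : HNat (2 * k + 2)) (M N : ℕ), 0 < M → 0 < N →
      ‖toL2 (2 * k + 2) x - zernikeProjL M N (toL2 (2 * k + 2) x)‖
        ≤ C * (min (M : ℝ) (2 * N)) ^ (-(2 * (k + ν))) * ‖opSpow k ν x‖ := by
  obtain ⟨C₁, hC₁, hb₁⟩ := exists_norm_sub_zernikeProj_le k
  obtain ⟨C₂, hC₂, hb₂⟩ := exists_norm_sub_zernikeProj_le (k + 1)
  set C := max C₁ C₂ with hC
  have hC0 : 0 < C := lt_max_of_lt_left hC₁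
  refine ⟨C, hC0, fun x M N hM hN => ?_⟩
  set a : ℝ := min (M : ℝ) (2 * N) with ha
  have ha0 : 0 < a := by
    have : (0 : ℝ) < M := by exact_mod_cast hM
    have : (0 : ℝ) < N := by exact_mod_cast hN
    positivity
  set T : HNat (2 * k + 2) →L[ℂ] L2Disc :=
    (ContinuousLinearMap.id ℂ L2Disc - zernikeProjL M N).comp (toL2 (2 * k + 2)) with hT
  have hTx : ∀ x, T x = toL2 (2 * k + 2) x - zernikeProjL M N (toL2 (2 * k + 2) x) :=
    fun x => rfl
  have e₁ : a ^ (-(2 * k : ℝ)) = (a ^ (2 * k))⁻¹ := by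
    rw [Real.rpow_neg ha0.le, ← Real.rpow_natCast]
    push_cast
    rfl
  have e₂ : a ^ (-(2 * k + 2 : ℝ)) = (a ^ (2 * (k + 1)))⁻¹ := by
    rw [Real.rpow_neg ha0.le, ← Real.rpow_natCast]
    push_cast
    ring_nf
  have hlow : ∀ x : HNat (2 * k + 2), ‖T x‖
      ≤ C * a ^ (-(2 * k : ℝ)) * ‖incl (Nat.le_add_right (2 * k) 2) x‖ := by
    intro x
    have h := hb₁ (incl (Nat.le_add_right (2 * k) 2) x) M N
    rw [toL2_incl, ← hTx, ← le_div_iff₀' (by positivity)] at h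
    refine h.trans ?_
    rw [e₁, div_eq_mul_inv, mul_right_comm]
    gcongr
    exact le_max_left _ _
  have hhigh : ∀ x : HNat (2 * k + 2), ‖T x‖ ≤ C * a ^ (-(2 * k + 2 : ℝ)) * ‖x‖ := by
    intro x
    have h : a ^ (2 * (k + 1)) * ‖T x‖ ≤ C₂ * ‖x‖ := hb₂ x M N
    rw [← le_div_iff₀' (by positivity)] at h
    refine h.trans ?_
    rw [e₂, div_eq_mul_inv, mul_right_comm]
    gcongr
    exact le_max_right _ _
  have hQ : ∀ x : HNat (2 * k + 2), ‖T x‖ ^ 2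
      ≤ (C * a ^ (-(2 * k : ℝ))) ^ 2 * RCLike.re (inner ℂ (opSq k x) x) := by
    intro x
    rw [← norm_sq_posSqrt (opSq_nonneg k) x, ← mul_pow]
    change _ ≤ (_ * ‖opS k x‖) ^ 2
    rw [norm_opS]
    exact pow_le_pow_left₀ (norm_nonneg _) (hlow x) 2
  have hpow : ∀ {b : ℝ}, 0 < b → b ^ (1 - ν) * b ^ ν = b := fun hb => by
    rw [← Real.rpow_add hb, sub_add_cancel, Real.rpow_one]
  -- the exponents combine to `-2k (1 - ν) - (2k + 2) ν = -2 (k + ν)`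
  have hconst : (C * a ^ (-(2 * k : ℝ))) ^ (1 - ν) * (C * a ^ (-(2 * k + 2 : ℝ))) ^ ν
      = C * a ^ (-(2 * (k + ν))) := by
    rw [Real.mul_rpow hC0.le (by positivity), Real.mul_rpow hC0.le (by positivity),
      ← Real.rpow_mul ha0.le, ← Real.rpow_mul ha0.le, mul_mul_mul_comm, hpow hC0,
      ← Real.rpow_add ha0]
    congr 2
    ring
  rw [← hTx, ← hconst]
  exact norm_le_norm_posRpow (opSq_nonneg k) (by positivity) (by positivity) h0 h1 hQ hhigh x

/-- The projection error for fractional order: the bound on `H^{2k+2}(D)` passes to the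
completion. -/
theorem exists_norm_sub_zernikeProj_le_frac (k : ℕ) {ν : ℝ} (h0 : 0 < ν) (h1 : ν < 1) :
    ∃ C : ℝ, 0 < C ∧ ∀ v w, (v, w) ∈ fracGraph k ν → ∀ M N : ℕ, 0 < M → 0 < N →
      ‖v - zernikeProjL M N v‖ ≤ C * (min (M : ℝ) (2 * N)) ^ (-(2 * (k + ν))) * ‖w‖ := by
  obtain ⟨C, hC, hb⟩ := exists_norm_sub_zernikeProj_le_opSpow k h0 h1
  refine ⟨C, hC, fun v w hvw M N hM hN => ?_⟩
  set c : ℝ := C * (min (M : ℝ) (2 * N)) ^ (-(2 * (k + ν)))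
  have hclosed : IsClosed {p : L2Disc × HNat (2 * k + 2) |
      ‖p.1 - zernikeProjL M N p.1‖ ≤ c * ‖p.2‖} :=
    isClosed_le ((continuous_fst.sub ((zernikeProjL M N).continuous.comp continuous_fst)).norm)
      (continuous_const.mul continuous_snd.norm)
  have hmem : (v, w) ∈ closure (Set.range fun u : HNat (2 * k + 2) =>
      (toL2 (2 * k + 2) u, opSpow k ν u)) := by
    have := hvw
    rw [fracGraph, ← SetLike.mem_coe, Submodule.topologicalClosure_coe] at this
    exact this
  have hsub : (Set.range fun u : HNat (2 * k + 2) => (toL2 (2 * k + 2) u, opSpow k ν u))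
      ⊆ {p : L2Disc × HNat (2 * k + 2) | ‖p.1 - zernikeProjL M N p.1‖ ≤ c * ‖p.2‖} := by
    rintro _ ⟨u, rfl⟩
    rw [Set.mem_ofPred_eq]
    exact hb u M N hM hN
  have hvw' := closure_minimal hsub hclosed hmem
  rw [Set.mem_ofPred_eq] at hvw'
  exact hvw'

end ZernikeDisc

end

open ZernikeDisc
theorem mainTheorem1 (s : ℝ) (hs : 0 < s) :
    ∃ P : ℝ, 0 < P ∧ ∀ v ∈ SobolevSpace s, ∀ M N : ℕ, 0 < M → 0 < N →
      ‖v - zernikeProj M N v‖ ≤ P * (min (M : ℝ) (2 * (N : ℝ))) ^ (-s) * sobolevNorm s v := by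
  have hsplit : s = 2 * (evenPart s + fracPart s) := by
    rw [fracPart]
    ring
  simp_rw [zernikeProj_eq]
  by_cases h : fracPart s = 0
  · obtain ⟨C, hC, hb⟩ := exists_norm_sub_zernikeProj_le (evenPart s)
    refine ⟨C, hC, fun v hv M N hM hN => ?_⟩
    rw [SobolevSpace, if_pos h] at hv
    obtain ⟨U, rfl⟩ := hv
    change ‖toL2 _ U - zernikeProjL M N (toL2 _ U)‖ ≤ _ * sobolevNorm s (toL2 _ U)
    have ha0 : 0 < min (M : ℝ) (2 * (N : ℝ)) := by
      have : (0 : ℝ) < M := by exact_mod_cast hM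
      have : (0 : ℝ) < N := by exact_mod_cast hN
      positivity
    have e : s = ((2 * evenPart s : ℕ) : ℝ) := by
      conv_lhs => rw [hsplit, h, add_zero]
      push_cast
      ring
    have e' : min (M : ℝ) (2 * (N : ℝ)) ^ s = min (M : ℝ) (2 * (N : ℝ)) ^ (2 * evenPart s) :=
      (congrArg _ e).trans (Real.rpow_natCast _ _)
    have h2 := hb U M N
    rw [← le_div_iff₀' (by positivity)] at h2
    rw [sobolevNorm_eq_of_even h, Real.rpow_neg ha0.le]
    refine h2.trans_eq ?_
    rw [e', div_eq_mul_inv, mul_right_comm]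
  · have hν0 : 0 < fracPart s :=
      lt_of_le_of_ne (sub_nonneg.2 (Nat.floor_le (by positivity))) (Ne.symm h)
    have hν1 : fracPart s < 1 := by
      have := Nat.lt_floor_add_one (s / 2)
      rw [fracPart, evenPart]
      linarith
    obtain ⟨C, hC, hb⟩ := exists_norm_sub_zernikeProj_le_frac (evenPart s) hν0 hν1
    refine ⟨C, hC, fun v hv M N hM hN => ?_⟩
    rw [SobolevSpace, if_neg h] at hv
    obtain ⟨⟨v', w⟩, hvw, rfl⟩ := hv
    have h2 := hb v' w hvw M N hM hN
    rw [← hsplit] at h2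
    change ‖v' - zernikeProjL M N v'‖ ≤ _ * sobolevNorm s v'
    rwa [sobolevNorm_eq_of_frac hs.le h hvw]
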